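/- Let $d\ge 2$, $\gamma>-1$ and $n\in\mathbb N_0$. For $\beta\ge-\frac12$ let $\mathbb V_0^{d+1}=\{(x,t)\in\mathbb R^d\times\mathbb R:\ \|x\|^2=t,\ 0\le t\le 1\}$ carry the measure $\mathrm d\sigma(x,t)=t^{\frac{d-1}2}\,\mathrm d\sigma_{\mathbb S}(\xi)\,\mathrm dt$ for $x=\sqrt t\,\xi$, $\xi\in\mathbb S^{d-1}$, where $\sigma_{\mathbb S}$ is the surface measure of $\mathbb S^{d-1}$, and put $\varpi_{\beta,\gamma}(t)=t^\beta(1-t)^\gamma$. Let $\mathsf P_n(\varpi_{\beta,\gamma};\cdot,\cdot)$ be the reproducing kernel of the space of orthogonal polynomials of degree $n$ in $(x,t)$, restricted to $\mathbb V_0^{d+1}$, with respect to the inner product $\langle f,g\rangle_{\beta,\gamma}=\mathsf b_{\beta,\gamma}\int_{\mathbb V_0^{d+1}}fg\,\varpi_{\beta,\gamma}\,\mathrm d\sigma$, where $\mathsf b_{\beta,\gamma}$ is chosen so that $\langle 1,1\rangle_{\beta,\gamma}=1$. For $a>-1$ and $b>-\frac12$ let $\mathbb U=\{(x_1,x_2):\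 x_1^2\le x_2\le 1\}$ and $U_{a,b}(x)=(1-x_2)^a(x_2-x_1^2)^{b-\frac12}$. Let $\mathbf P_n(U_{a,b};\cdot,\cdot)$ be the reproducing kernel of the space of orthogonal polynomials of degree $n$ in two variables with respect to $\langle f,g\rangle_{\mathbb U}=\mathbf d_{a,b}\int_{\mathbb U}fg\,U_{a,b}\,\mathrm dx$, where $\mathbf d_{a,b}$ is chosen so that $\langle 1,1\rangle_{\mathbb U}=1$. Here the orthogonal polynomials of degree $n$ (together with $0$) are the polynomials of degree at most $n$ that are orthogonal to all polynomials of degree less than $n$, and the reproducing kernel of such a space $\mathcal V$ is the unique $K$ with $K(p,\cdot)\in\mathcal V$ and $\langle f,K(p,\cdot)\rangle=f(p)$ for all $f\in\mathcal V$ and all points $p$. Write $$c'_{a,b}=\frac{\Gamma(a+b+2)}{2^{a+b+1}\,\Gamma(a+1)\Gamma(b+1)},\qquad c_\lambda=\frac{\Gamma(\lambda+1)}{\Gamma(\frac12)\Gamma(\lambda+\frac12)}.$$ Then these reproducing kernels exist, and for all $(x,t)=(\sqrt t\,\xi,t)$ and $(y,s)=(\sqrt s\,\eta,s)$ in $\mathbb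 V_0^{d+1}$ with $\xi,\eta\in\mathbb S^{d-1}$ the following holds. For $\beta>-\frac12$, $$\mathsf P_n\big(\varpi_{\beta,\gamma};(x,t),(y,s)\big)=c'_{\frac{d-2}2,\beta-\frac12}\,c_{\beta+\frac12}\int_{-1}^1\!\int_{-1}^1\mathbf P_n\Big(U_{\gamma,\beta+\frac{d-1}2};\big(\sqrt t,t\big),\big(\sqrt s\,(\tfrac{1-z_1}2\langle\xi,\eta\rangle+\tfrac{1+z_1}2z_2),\,s\big)\Big)(1-z_1)^{\frac{d-2}2}(1+z_1)^{\beta-\frac12}(1-z_2^2)^{\beta}\,\mathrm dz_1\,\mathrm dz_2,$$ where the integrand is absolutely integrable on $[-1,1]^2$, and for $\beta=-\frac12$, $$\mathsf P_n\big(\varpi_{-\frac12,\gamma};(x,t),(y,s)\big)=\mathbf P_n\Big(U_{\gamma,\frac{d-2}2};\big(\sqrt t,t\big),\big(\langle\xi,y\rangle,s\big)\Big).$$ -/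

import Mathlib

open MeasureTheory Set

noncomputable section

namespace Paraboloid

/-! ### Reproducing kernels -/

/-- `K` is a reproducing kernel of the set `V` of functions on `X` with respect to the form `ip`:
every section `K x` lies in `V`, and `⟨f, K x⟩ = f x` for all `f ∈ V`. -/
structure IsReproducingKernel {X : Type*} (ip : (X → ℝ) → (X → ℝ) → ℝ) (V : Set (X → ℝ))
    (K : X → X → ℝ) : Prop where
  mem : ∀ x, K x ∈ V
  reproducing : ∀ f ∈ V, ∀ x, ip f (K x) = f x

/-- A symmetric form has at most one reproducing kernel on `V`. -/
theorem IsReproducingKernel.unique {X : Type*} {ip : (X → ℝ) → (X → ℝ) → ℝ}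
    (hsymm : ∀ f g, ip f g = ip g f) {V : Set (X → ℝ)} {K L : X → X → ℝ}
    (hK : IsReproducingKernel ip V K) (hL : IsReproducingKernel ip V L) : K = L := by
  funext x y
  rw [← hL.reproducing _ (hK.mem x) y, hsymm, hK.reproducing _ (hL.mem y) x,
    ← hL.reproducing _ (hL.mem y) x, hsymm, hL.reproducing _ (hL.mem x) y]

/-- The reproducing kernel of `V` with respect to `ip` (an arbitrary function if there is none). -/
def reproducingKernel {X : Type*} (ip : (X → ℝ) → (X → ℝ) → ℝ) (V : Set (X → ℝ)) : X → X → ℝ :=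
  Classical.epsilon (IsReproducingKernel ip V)

/-! ### The parabolic domain in the plane -/

/-- The parabolic domain `𝕌 = {(x₁, x₂) : x₁² ≤ x₂ ≤ 1}`. -/
def parabolicDomain : Set (ℝ × ℝ) := {x | x.1 ^ 2 ≤ x.2 ∧ x.2 ≤ 1}

/-- The weight `U_{a,b}(x) = (1 - x₂)^a (x₂ - x₁²)^(b - 1/2)`. -/
def parabolicWeight (a b : ℝ) (x : ℝ × ℝ) : ℝ :=
  (1 - x.2) ^ a * (x.2 - x.1 ^ 2) ^ (b - 1 / 2)

/-- The inner product on `𝕌` with weight `U_{a,b}`, normalized so that `⟨1, 1⟩ = 1`. -/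
def parabolicInner (a b : ℝ) (f g : ℝ × ℝ → ℝ) : ℝ :=
  (∫ x in parabolicDomain, parabolicWeight a b x)⁻¹ *
    ∫ x in parabolicDomain, f x * g x * parabolicWeight a b x

/-- The function on the plane given by a polynomial in two variables. -/
def planePoly (p : MvPolynomial (Fin 2) ℝ) (x : ℝ × ℝ) : ℝ :=
  MvPolynomial.eval ![x.1, x.2] p

/-- The orthogonal polynomials of degree `n` for `U_{a,b}` on `𝕌` (and zero): polynomials of degree
at most `n` that are orthogonal to all polynomials of degree less than `n`. They are regarded as
functions on the whole plane, which is harmless since `𝕌` has non-empty interior. -/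
def parabolicOP (a b : ℝ) (n : ℕ) : Set (ℝ × ℝ → ℝ) :=
  {f | (∃ p : MvPolynomial (Fin 2) ℝ, p.totalDegree ≤ n ∧ f = planePoly p) ∧
    ∀ q : MvPolynomial (Fin 2) ℝ, q.totalDegree < n → parabolicInner a b f (planePoly q) = 0}

/-- The reproducing kernel of the orthogonal polynomials of degree `n` for `U_{a,b}` on `𝕌`. -/
def parabolicKernel (a b : ℝ) (n : ℕ) : ℝ × ℝ → ℝ × ℝ → ℝ :=
  reproducingKernel (parabolicInner a b) (parabolicOP a b n)

/-! ### The surface of the paraboloid -/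

/-- The surface `{(x, t) : ‖x‖² = t, 0 ≤ t ≤ 1}` of the paraboloid in `ℝ^d × ℝ`. -/
def surface (d : ℕ) : Set (EuclideanSpace ℝ (Fin d) × ℝ) :=
  {p | ‖p.1‖ ^ 2 = p.2 ∧ 0 ≤ p.2 ∧ p.2 ≤ 1}

/-- The point `(√t ξ, t)` of the surface, for `ξ` in the unit sphere and `t ∈ [0, 1]`. -/
def surfacePoint {d : ℕ} (ξ : Metric.sphere (0 : EuclideanSpace ℝ (Fin d)) 1) (t : Icc (0 : ℝ) 1) :
    surface d :=
  ⟨(√(t : ℝ) • (ξ : EuclideanSpace ℝ (Fin d)), (t : ℝ)), by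
    have hξ : ‖(ξ : EuclideanSpace ℝ (Fin d))‖ = 1 := by simp
    refine ⟨?_, t.2.1, t.2.2⟩
    simp [norm_smul, hξ, abs_of_nonneg (Real.sqrt_nonneg _), Real.sq_sqrt t.2.1]⟩

/-- The measure `dσ(x, t) = t^((d-1)/2) dσ_𝕊(ξ) dt`, `x = √t ξ`, on the surface, where `σ_𝕊` is the
surface measure of the unit sphere. -/
def surfaceMeasure (d : ℕ) : Measure (surface d) :=
  ((volume : Measure (EuclideanSpace ℝ (Fin d))).toSphere.prod
      ((volume : Measure (Icc (0 : ℝ) 1)).withDensity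
        fun t => ENNReal.ofReal ((t : ℝ) ^ (((d : ℝ) - 1) / 2)))).map
    fun p => surfacePoint p.1 p.2

/-- The weight `ϖ_{β,γ}(t) = t^β (1 - t)^γ`. -/
def surfaceWeight (β γ t : ℝ) : ℝ := t ^ β * (1 - t) ^ γ

/-- The inner product on the surface with weight `ϖ_{β,γ}`, normalized so that `⟨1, 1⟩ = 1`. -/
def surfaceInner (d : ℕ) (β γ : ℝ) (f g : surface d → ℝ) : ℝ :=
  (∫ p : surface d, surfaceWeight β γ p.1.2 ∂surfaceMeasure d)⁻¹ *
    ∫ p : surface d, f p * g p * surfaceWeight β γ p.1.2 ∂surfaceMeasure d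

/-- The restriction to the surface of a polynomial in the `d + 1` variables `(x, t)`. -/
def surfacePoly {d : ℕ} (P : MvPolynomial (Fin d ⊕ Unit) ℝ) (p : surface d) : ℝ :=
  MvPolynomial.eval (Sum.elim (fun i => p.1.1 i) fun _ => p.1.2) P

/-- The orthogonal polynomials of degree `n` for `ϖ_{β,γ}` on the surface (and zero): restrictions
of polynomials of degree at most `n` that are orthogonal to all polynomials of degree less
than `n`. -/
def surfaceOP (d : ℕ) (β γ : ℝ) (n : ℕ) : Set (surface d → ℝ) :=
  {f | (∃ P : MvPolynomial (Fin d ⊕ Unit) ℝ, P.totalDegree ≤ n ∧ f = surfacePoly P) ∧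
    ∀ Q : MvPolynomial (Fin d ⊕ Unit) ℝ, Q.totalDegree < n →
      surfaceInner d β γ f (surfacePoly Q) = 0}

/-- The reproducing kernel of the orthogonal polynomials of degree `n` for `ϖ_{β,γ}` on the
surface. -/
def surfaceKernel (d : ℕ) (β γ : ℝ) (n : ℕ) : surface d → surface d → ℝ :=
  reproducingKernel (surfaceInner d β γ) (surfaceOP d β γ n)

/-! ### The integral over the square -/

/-- `Γ(a+b+2) / (2^(a+b+1) Γ(a+1) Γ(b+1))`, the normalization constant of `(1-x)^a (1+x)^b`
on `[-1, 1]`. -/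
def jacobiConst (a b : ℝ) : ℝ :=
  2 ^ (-a - b - 1) * (Real.Gamma (a + b + 2) / (Real.Gamma (a + 1) * Real.Gamma (b + 1)))

/-- `Γ(l+1) / (Γ(1/2) Γ(l+1/2))`, the normalization constant of `(1-x²)^(l-1/2)` on `[-1, 1]`. -/
def gegenbauerConst (l : ℝ) : ℝ :=
  Real.Gamma (l + 1) / (Real.Gamma (1 / 2) * Real.Gamma (l + 1 / 2))

/-- The integrand over `z ∈ [-1, 1]²`: the kernel on `𝕌` with first argument `(√t, t)` and second
argument `(√s ((1-z₁)/2 u + (1+z₁)/2 z₂), s)`, times the weight in `z`. -/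
def squareIntegrand (d : ℕ) (β γ : ℝ) (n : ℕ) (t s u : ℝ) (z : ℝ × ℝ) : ℝ :=
  parabolicKernel γ (β + ((d : ℝ) - 1) / 2) n (√t, t)
      (√s * ((1 - z.1) / 2 * u + (1 + z.1) / 2 * z.2), s) *
    ((1 - z.1) ^ (((d : ℝ) - 2) / 2) * (1 + z.1) ^ (β - 1 / 2) * (1 - z.2 ^ 2) ^ β)

end Paraboloid

end

noncomputable section

namespace Paraboloid

open Polynomial ProbabilityTheory

/-! ### Beta averages of polynomials -/

/-! Put `b = β + (d-1)/2` and `l = (d-2)/2`. In the coordinates `(√s η, s)` on the surface and `(√s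
u, s)` on `𝕌`, both normalized measures are products with the same law of `s`, namely Beta(`b+1`,
`γ+1`). They differ in the angular factor only: the uniform sphere on one side, `u` with weight
`(1-u²)^(b-1/2)` on the other. On the sphere, functions of `⟨ξ,η⟩` see the weight `(1-u²)^(l-1/2)`,
so what is needed is a passage from the parameter `b` to `l`.

Let `τ` be linear on polynomials in `u` with `τ Z_n^b = Z_n^l`, where `Z_n^l = (n+l)/l · C_n^l`. For
every parameter the squared norm of `Z_n` equals `Z_n(1)`, so the adjoint of `τ` preserves values at
`1` (`exists_adjoint`). Given a polynomial `Q` on the surface and a direction `ξ`, averaging about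
the axis `ξ` (`exists_zonal_projection`) and then applying the adjoint gives a plane polynomial `q`
of no larger degree, with `q(√t,t) = Q(√t ξ,t)` and `⟨Q, τg(⟨ξ,·⟩)⟩ = ⟨q, g⟩` for all `g`
(`exists_transfer`). Taking for `g` the section of the kernel of `𝕌` at `(√t,t)`, the function
`τg(⟨ξ,·⟩)` is the section of the surface kernel at `(√t ξ,t)` (`exists_surface_section`). Parity
keeps everything polynomial of the right degree: `r^i f(u)` is a polynomial in `(ru, r²)` of degree
at most `i` when `f` has degree at most `i` and the parity of `i`.

For `β = -1/2` one has `b = l` and `τ` is the identity. For `β > -1/2` put `s = b - l = β + 1/2 >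
0`; then `τ` averages over `p x + (1-p) z` with `p` of law Beta(`l+1`, `s`) and `z` of weight
`(1-z²)^(s-1/2)` (`averageMap_zonalPoly`). Its key is the beta integral `E (pU + (1-p)V)^(-a-b) =
U^(-a) V^(-b)`, read on Gegenbauer generating series (`betaMean_gegenbauerPoly`). The double average
becomes the integral over the square after `z₁ = 1 - 2p`. -/

theorem integrable_of_continuous_of_compl_null {X : Type*} [TopologicalSpace X] [MeasurableSpace X]
    [BorelSpace X] [T2Space X] {μ : Measure X} [IsFiniteMeasure μ] {K : Set X} (hK : IsCompact K)
    (h : μ Kᶜ = 0) {f : X → ℝ} (hf : Continuous f) : Integrable f μ := by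
  rw [← Measure.restrict_eq_self_of_ae_mem (s := K) (μ := μ) (mem_ae_iff.2 h)]
  exact hf.continuousOn.integrableOn_compact' hK hK.measurableSet

theorem betaMeasure_compl_Icc (a b : ℝ) : betaMeasure a b (Icc 0 1)ᶜ = 0 := by
  rw [betaMeasure, withDensity_apply _ measurableSet_Icc.compl]
  refine setLIntegral_eq_zero measurableSet_Icc.compl fun x hx => ?_
  rw [betaPDF_eq, if_neg fun h => hx ⟨h.1.le, h.2.le⟩, ENNReal.ofReal_zero, Pi.zero_apply]

theorem integrable_betaMeasure {a b : ℝ} (ha : 0 < a) (hb : 0 < b) {f : ℝ → ℝ}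
    (hf : Continuous f) : Integrable f (betaMeasure a b) := by
  have := isProbabilityMeasureBeta ha hb
  exact integrable_of_continuous_of_compl_null isCompact_Icc (betaMeasure_compl_Icc a b) hf

theorem betaPDFReal_nonneg {a b : ℝ} (ha : 0 < a) (hb : 0 < b) (x : ℝ) :
    0 ≤ betaPDFReal a b x := by
  by_cases h : 0 < x ∧ x < 1
  · exact (betaPDFReal_pos h.1 h.2 ha hb).le
  · rw [betaPDFReal, if_neg h]

theorem integral_betaMeasure {a b : ℝ} (ha : 0 < a) (hb : 0 < b) (f : ℝ → ℝ) :
    ∫ p, f p ∂betaMeasure a b = ∫ p, betaPDFReal a b p * f p := by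
  rw [betaMeasure, integral_withDensity_eq_integral_toReal_smul]
  · simp [betaPDF, ENNReal.toReal_ofReal (betaPDFReal_nonneg ha hb _)]
  · exact (measurable_betaPDFReal a b).ennreal_ofReal
  · simp [betaPDF]

/-- A factor `p` raises the first exponent of the density; the constant is the quotient of the two
beta functions. -/
theorem integral_betaMeasure_mul_left {a b : ℝ} (ha : 0 < a) (hb : 0 < b) (f : ℝ → ℝ) :
    ∫ p, p * f p ∂betaMeasure a b = a / (a + b) * ∫ p, f p ∂betaMeasure (a + 1) b := by
  rw [integral_betaMeasure ha hb, integral_betaMeasure (by linarith) hb, ← integral_const_mul]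
  refine integral_congr_ae (.of_forall fun p => ?_)
  simp only [betaPDFReal]
  split_ifs with h
  · have e1 : p ^ (a + 1 - 1) = p ^ (a - 1) * p := by
      rw [← Real.rpow_add_one h.1.ne']; ring_nf
    have h1 := (Real.Gamma_pos_of_pos ha).ne'
    have h2 := (Real.Gamma_pos_of_pos hb).ne'
    have h3 := (Real.Gamma_pos_of_pos (add_pos ha hb)).ne'
    have h4 : a + b ≠ 0 := (add_pos ha hb).ne'
    rw [e1, beta, beta, show a + 1 + b = a + b + 1 by ring, Real.Gamma_add_one ha.ne',
      Real.Gamma_add_one h4]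
    field_simp
  · simp

theorem integral_betaMeasure_mul_right {a b : ℝ} (ha : 0 < a) (hb : 0 < b) (f : ℝ → ℝ) :
    ∫ p, (1 - p) * f p ∂betaMeasure a b = b / (a + b) * ∫ p, f p ∂betaMeasure a (b + 1) := by
  rw [integral_betaMeasure ha hb, integral_betaMeasure ha (by linarith), ← integral_const_mul]
  refine integral_congr_ae (.of_forall fun p => ?_)
  simp only [betaPDFReal]
  split_ifs with h
  · have e1 : (1 - p) ^ (b + 1 - 1) = (1 - p) ^ (b - 1) * (1 - p) := by
      rw [← Real.rpow_add_one (by linarith [h.2])]; ring_nf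
    have h1 := (Real.Gamma_pos_of_pos ha).ne'
    have h2 := (Real.Gamma_pos_of_pos hb).ne'
    have h3 := (Real.Gamma_pos_of_pos (add_pos ha hb)).ne'
    have h4 : a + b ≠ 0 := (add_pos ha hb).ne'
    rw [e1, beta, beta, show a + (b + 1) = a + b + 1 by ring, Real.Gamma_add_one hb.ne',
      Real.Gamma_add_one h4]
    field_simp
  · simp

/-- The average of a polynomial over the segment from `z` to `u` for the beta distribution. -/
def betaMean (a b u z : ℝ) : ℝ[X] →ₗ[ℝ] ℝ :=
  lsum fun k => LinearMap.toSpanSingleton ℝ ℝ (∫ p, (p * u + (1 - p) * z) ^ k ∂betaMeasure a b)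

theorem betaMean_apply {a b : ℝ} (ha : 0 < a) (hb : 0 < b) (u z : ℝ) (φ : ℝ[X]) :
    betaMean a b u z φ = ∫ p, φ.eval (p * u + (1 - p) * z) ∂betaMeasure a b := by
  simp only [eval_eq_sum, Polynomial.sum_def]
  rw [integral_finsetSum _ fun k _ => integrable_betaMeasure ha hb (by fun_prop), betaMean,
    lsum_apply, Polynomial.sum_def]
  exact Finset.sum_congr rfl fun k _ => by rw [integral_const_mul]; simp

theorem betaMean_one {a b : ℝ} (ha : 0 < a) (hb : 0 < b) (u z : ℝ) : betaMean a b u z 1 = 1 := by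
  have := isProbabilityMeasureBeta ha hb
  simp [betaMean_apply ha hb]

/-- Insert `1 = p + (1 - p)`; inserting instead the point `p u + (1 - p) z` itself gives
`betaMean_X_mul`. The two relations together drive `betaMean_gegenbauerPoly`. -/
theorem betaMean_contiguous {a b : ℝ} (ha : 0 < a) (hb : 0 < b) (u z : ℝ) (φ : ℝ[X]) :
    betaMean a b u z φ = a / (a + b) * betaMean (a + 1) b u z φ +
      b / (a + b) * betaMean a (b + 1) u z φ := by
  rw [betaMean_apply ha hb, betaMean_apply (by linarith) hb, betaMean_apply ha (by linarith),
    ← integral_betaMeasure_mul_left ha hb, ← integral_betaMeasure_mul_right ha hb, ← integral_add]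
  · exact integral_congr_ae (.of_forall fun p => by ring)
  all_goals exact integrable_betaMeasure ha hb (by fun_prop)

theorem betaMean_X_mul {a b : ℝ} (ha : 0 < a) (hb : 0 < b) (u z : ℝ) (φ : ℝ[X]) :
    betaMean a b u z (X * φ) = a / (a + b) * (u * betaMean (a + 1) b u z φ) +
      b / (a + b) * (z * betaMean a (b + 1) u z φ) := by
  rw [betaMean_apply ha hb, betaMean_apply (by linarith) hb, betaMean_apply ha (by linarith),
    mul_left_comm, mul_left_comm (b / (a + b)), ← integral_betaMeasure_mul_left ha hb,
    ← integral_betaMeasure_mul_right ha hb, ← integral_const_mul, ← integral_const_mul,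
    ← integral_add]
  · exact integral_congr_ae (.of_forall fun p => by simp; ring)
  all_goals exact integrable_betaMeasure ha hb (by fun_prop)

/-- The average of a polynomial over `[-1, 1]` for the weight `(1 - x²)^(l - 1/2)`. -/
def gegenbauerMean (l : ℝ) : ℝ[X] →ₗ[ℝ] ℝ := betaMean (l + 1 / 2) (l + 1 / 2) (-1) 1

theorem gegenbauerMean_one {l : ℝ} (hl : -1 / 2 < l) : gegenbauerMean l 1 = 1 :=
  betaMean_one (by linarith) (by linarith) _ _

/-- At `x = 1 - 2p` one has `1 - x² = 4p(1-p)`, so both beta parameters rise by one. -/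
theorem gegenbauerMean_one_sub_sq_mul {l : ℝ} (hl : -1 / 2 < l) (φ : ℝ[X]) :
    gegenbauerMean l ((1 - X ^ 2) * φ) =
      (2 * l + 1) / (2 * l + 2) * gegenbauerMean (l + 1) φ := by
  have h : 0 < l + 1 / 2 := by linarith
  have h' : 0 < l + 1 / 2 + 1 := by linarith
  have e : l + 1 + 1 / 2 = l + 1 / 2 + 1 := by ring
  rw [gegenbauerMean, gegenbauerMean, e, betaMean_apply h h, betaMean_apply h' h']
  have : ∀ p : ℝ, ((1 - X ^ 2) * φ).eval (p * -1 + (1 - p) * 1) =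
      4 * (p * ((1 - p) * φ.eval (p * -1 + (1 - p) * 1))) := fun p => by
    simp only [eval_mul, eval_sub, eval_one, eval_pow, eval_X]; ring
  simp_rw [this]
  rw [integral_const_mul, integral_betaMeasure_mul_left h h, integral_betaMeasure_mul_right h' h]
  rw [← mul_assoc, ← mul_assoc, show l + 1 / 2 + 1 + (l + 1 / 2) = 2 * l + 2 by ring,
    show l + 1 / 2 + (l + 1 / 2) = 2 * l + 1 by ring]
  congr 1
  have : 2 * l + 2 ≠ 0 := by linarith
  have : 2 * l + 1 ≠ 0 := by linarith
  field_simp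
  ring

/-- This is the vanishing of the integral of the derivative of `p^a (1-p)^b g(p)`. It is checked on
monomials from the parameter shifts, so no boundary terms have to be controlled. -/
theorem betaMean_stein {a b : ℝ} (ha : 0 < a) (hb : 0 < b) (g : ℝ[X]) :
    betaMean a b 1 0 (X * (1 - X) * derivative g + (C a * (1 - X) - C b * X) * g) = 0 := by
  induction g using Polynomial.induction_on' with
  | add p q hp hq =>
    rw [show ∀ r : ℝ[X], X * (1 - X) * derivative (p + q) + r * (p + q) =
      (X * (1 - X) * derivative p + r * p) + (X * (1 - X) * derivative q + r * q) by
        intro r; rw [derivative_add]; ring, map_add, hp, hq, add_zero]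
  | monomial k c =>
    have hk : (k : ℝ) + a ≠ 0 := by positivity
    have e : X * (1 - X) * derivative (monomial k c) + (C a * (1 - X) - C b * X) * monomial k c =
        C c * (C (k + a) * (X ^ k * (1 - X)) - C b * X ^ (k + 1)) := by
      rw [derivative_monomial, ← C_mul_X_pow_eq_monomial, ← C_mul_X_pow_eq_monomial]
      cases k with
      | zero => simp; ring
      | succ k => simp; ring
    rw [e, ← smul_eq_C_mul, map_smul, map_sub, ← smul_eq_C_mul, ← smul_eq_C_mul, map_smul,
      map_smul, betaMean_apply ha hb, betaMean_apply ha hb]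
    -- The induction on `k` absorbs one factor `p` into the measure, so `a` must be allowed to grow
    -- to `a + 1`.
    have key : ∀ k : ℕ, ∀ a : ℝ, 0 < a → (k + a) * ∫ p, p ^ k * (1 - p) ∂betaMeasure a b =
        b * ∫ p, p ^ (k + 1) ∂betaMeasure a b := by
      intro k
      induction k with
      | zero =>
        intro a ha
        have h1 := integral_betaMeasure_mul_left ha hb fun _ => 1
        have h2 := integral_betaMeasure_mul_right ha hb fun _ => 1
        have := isProbabilityMeasureBeta (α := a + 1) (by linarith) hb
        have := isProbabilityMeasureBeta (β := b + 1) ha (by linarith)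
        simp only [mul_one, integral_const, probReal_univ, smul_eq_mul] at h1 h2
        simp [h1, h2]
        ring
      | succ k ih =>
        intro a ha
        have h1 := integral_betaMeasure_mul_left ha hb fun p => p ^ k * (1 - p)
        have h2 := integral_betaMeasure_mul_left ha hb fun p => p ^ (k + 1)
        have h3 := ih (a + 1) (by linarith)
        simp only [← mul_assoc, ← pow_succ'] at h1 h2
        rw [h1, h2]
        push_cast
        linear_combination a / (a + b) * h3
    have h := key k a ha
    simp only [mul_one, mul_zero, add_zero, eval_mul, eval_pow, eval_X, eval_sub, eval_one,
      smul_eq_mul]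
    rw [h]
    ring

theorem gegenbauerMean_stein {l : ℝ} (hl : -1 / 2 < l) (f : ℝ[X]) :
    gegenbauerMean l ((1 - X ^ 2) * derivative f) =
      (2 * l + 1) * gegenbauerMean l (X * f) := by
  have h : 0 < l + 1 / 2 := by linarith
  have hs := betaMean_stein h h (f.comp (1 - 2 * X))
  rw [betaMean_apply h h] at hs
  rw [← sub_eq_zero, ← smul_eq_mul (2 * l + 1), ← map_smul (gegenbauerMean l), ← map_sub,
    gegenbauerMean, betaMean_apply h h,
    ← mul_zero (-2 : ℝ), ← hs, ← integral_const_mul]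
  refine integral_congr_ae (.of_forall fun p => ?_)
  have e : (p * -1 + (1 - p) * 1) = 1 - 2 * p := by ring
  simp only [derivative_comp, e]
  simp
  ring

theorem gegenbauerMean_X {l : ℝ} (hl : -1 / 2 < l) : gegenbauerMean l X = 0 := by
  have h := gegenbauerMean_stein hl 1
  have h0 : 2 * l + 1 ≠ 0 := by linarith
  simpa [h0] using h

/-- Integration by parts against `X ^ (k + 1)`. The same recursion governs moments of one coordinate
on the sphere, which is how the two averages are matched. -/
theorem gegenbauerMean_X_pow_add_two {l : ℝ} (hl : -1 / 2 < l) (k : ℕ) :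
    (k + 2 + 2 * l) * gegenbauerMean l (X ^ (k + 2)) = (k + 1) * gegenbauerMean l (X ^ k) := by
  have h := gegenbauerMean_stein hl (X ^ (k + 1))
  have e : (1 - X ^ 2) * derivative (X ^ (k + 1) : ℝ[X]) =
      (k + 1 : ℝ) • (X ^ k - X ^ (k + 2)) := by
    simp [smul_eq_C_mul]; ring
  rw [e, map_smul, map_sub, smul_eq_mul, ← pow_succ'] at h
  linear_combination -h

theorem gegenbauerMean_X_pow_odd {l : ℝ} (hl : -1 / 2 < l) (k : ℕ) :
    gegenbauerMean l (X ^ (2 * k + 1)) = 0 := by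
  induction k with
  | zero => simpa using gegenbauerMean_X hl
  | succ k ih =>
    have h := gegenbauerMean_X_pow_add_two hl (2 * k + 1)
    rw [ih, mul_zero, mul_eq_zero] at h
    refine h.resolve_left ?_
    push_cast
    have : (0 : ℝ) ≤ k := k.cast_nonneg
    linarith

/-! ### Gegenbauer polynomials -/

/-- The Gegenbauer polynomial of degree `n` with parameter `a`, for every real `a`. -/
def gegenbauerPoly : ℕ → ℝ → ℝ[X]
  | 0, _ => 1
  | 1, a => C (2 * a) * X
  | n + 2, a => C (2 * a / (n + 2)) * (X * gegenbauerPoly (n + 1) (a + 1) -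
      gegenbauerPoly n (a + 1))

theorem gegenbauerPoly_add_two (n : ℕ) (a : ℝ) :
    C (n + 2 : ℝ) * gegenbauerPoly (n + 2) a =
      C (2 * a) * (X * gegenbauerPoly (n + 1) (a + 1) - gegenbauerPoly n (a + 1)) := by
  rw [gegenbauerPoly, ← mul_assoc, ← C_mul, mul_div_cancel₀ _ (by positivity)]

theorem derivative_gegenbauerPoly (n : ℕ) (a : ℝ) :
    derivative (gegenbauerPoly (n + 1) a) = C (2 * a) * gegenbauerPoly n (a + 1) := by
  induction n using Nat.twoStepInduction generalizing a with
  | zero => simp [gegenbauerPoly]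
  | one =>
    simp [gegenbauerPoly, map_ofNat C 2]
    ring
  | more n ih' ih =>
    have h0 : (C (n + 3 : ℝ) : ℝ[X]) ≠ 0 := by
      rw [Ne, C_eq_zero]; positivity
    have h := congrArg derivative (gegenbauerPoly_add_two (n + 1) a)
    have h1 := gegenbauerPoly_add_two n (a + 1)
    have h2 := ih' (a + 1)
    have h3 := ih (a + 1)
    rw [derivative_C_mul, derivative_C_mul, derivative_sub, derivative_mul, h2, h3, derivative_X]
      at h
    refine mul_left_cancel₀ h0 ?_
    have e : ((n + 1 : ℕ) : ℝ) + 2 = n + 3 := by push_cast; ring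
    rw [e] at h
    rw [h]
    have : (C (n + 3 : ℝ) : ℝ[X]) = C (n + 2 : ℝ) + 1 := by
      rw [← C_1, ← C_add]; congr 1; ring
    rw [this]
    linear_combination -C (2 * a) * h1

/-- The generating series of the Gegenbauer polynomials. -/
def gegenbauerSeries (a : ℝ) : PowerSeries ℝ[X] := PowerSeries.mk fun n => gegenbauerPoly n a

/-- The defining recursion is the coefficient form of `d/dr (1 - 2xr + r²)^(-a) = 2a (x - r) (1 -
2xr + r²)^(-a-1)`. -/
theorem derivative_gegenbauerSeries (a : ℝ) :
    PowerSeries.derivative ℝ[X] (gegenbauerSeries a) =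
      PowerSeries.C (C (2 * a)) * ((PowerSeries.C X - PowerSeries.X) *
        gegenbauerSeries (a + 1)) := by
  ext1 n
  rw [PowerSeries.coeff_derivative, PowerSeries.coeff_C_mul, sub_mul, map_sub,
    PowerSeries.coeff_C_mul]
  cases n with
  | zero => simp [gegenbauerSeries, gegenbauerPoly]
  | succ n =>
    rw [PowerSeries.coeff_succ_X_mul]
    simp only [gegenbauerSeries, PowerSeries.coeff_mk]
    rw [← gegenbauerPoly_add_two]
    simp [map_ofNat C 2]
    ring

/-- A family of power series with vanishing constant terms whose derivatives are combinations of
members of the family vanishes. -/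
theorem eq_zero_of_derivative_mem_span {R ι : Type*} [CommRing R] [IsAddTorsionFree R]
    {F : ι → PowerSeries R} (h0 : ∀ i, PowerSeries.constantCoeff (F i) = 0)
    (h : ∀ i, PowerSeries.derivative R (F i) ∈ Ideal.span (range F)) (i : ι) : F i = 0 := by
  -- If `X ^ n` divides every member, it divides every derivative; with zero constant term and no
  -- torsion, `X ^ (n + 1)` then divides every member.
  have key : ∀ n : ℕ, ∀ i, PowerSeries.X ^ n ∣ F i := by
    intro n
    induction n with
    | zero => simp
    | succ n ih =>
      intro i
      have hle : Ideal.span (range F) ≤ Ideal.span {PowerSeries.X ^ n} := by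
        rw [Ideal.span_le]
        rintro _ ⟨j, rfl⟩
        exact Ideal.mem_span_singleton.2 (ih j)
      have hd := PowerSeries.X_pow_dvd_iff.1 (Ideal.mem_span_singleton.1 (hle (h i)))
      rw [PowerSeries.X_pow_dvd_iff]
      intro m hm
      cases m with
      | zero => simpa using h0 i
      | succ m =>
        have := hd m (by omega)
        rw [PowerSeries.coeff_derivative, mul_comm, ← Nat.cast_succ, ← nsmul_eq_mul] at this
        exact (smul_eq_zero.1 this).resolve_left (by omega)
  ext1 n
  exact PowerSeries.X_pow_dvd_iff.1 (key (n + 1) i) n (Nat.lt_succ_self n)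

/-- Real powers of `1 - 2xr + r²` are avoided: the derivative of the defect at `a` is a multiple of
the defect at `a + 1`, so the whole family of defects vanishes at once. -/
theorem gegenbauerSeries_add_one (a : ℝ) :
    (1 - 2 * PowerSeries.C X * PowerSeries.X + PowerSeries.X ^ 2) * gegenbauerSeries (a + 1) =
      gegenbauerSeries a := by
  rw [← sub_eq_zero]
  refine eq_zero_of_derivative_mem_span (F := fun a : ℝ =>
    (1 - 2 * PowerSeries.C X * PowerSeries.X + PowerSeries.X ^ 2) * gegenbauerSeries (a + 1) -
      gegenbauerSeries a) (fun a => ?_) (fun a => ?_) a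
  · simp [gegenbauerSeries, gegenbauerPoly]
  · have e : PowerSeries.derivative ℝ[X] ((1 - 2 * PowerSeries.C X * PowerSeries.X +
        PowerSeries.X ^ 2) * gegenbauerSeries (a + 1) - gegenbauerSeries a) =
        (PowerSeries.C (C (2 * (a + 1))) * (PowerSeries.C X - PowerSeries.X)) *
        ((1 - 2 * PowerSeries.C X * PowerSeries.X + PowerSeries.X ^ 2) *
          gegenbauerSeries (a + 1 + 1) - gegenbauerSeries (a + 1)) := by
      have h2 : PowerSeries.derivative ℝ[X] (2 : PowerSeries ℝ[X]) = 0 := by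
        rw [← map_ofNat (PowerSeries.C (R := ℝ[X])) 2, PowerSeries.derivative_C]
      simp only [map_sub, map_add, Derivation.leibniz, derivative_gegenbauerSeries, PowerSeries.derivative_one, h2,
        PowerSeries.derivative_C, PowerSeries.derivative_X, smul_eq_mul, pow_two, map_mul, map_one,
        map_ofNat]
      ring
    rw [e]
    exact Ideal.mul_mem_left _ _ (Ideal.subset_span ⟨a + 1, rfl⟩)

/-- The zonal polynomial `(n + l) / l * C_n^l`, extended to `l = 0` by continuity. -/
def zonalPoly (l : ℝ) : ℕ → ℝ[X]
  | 0 => 1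
  | 1 => gegenbauerPoly 1 (l + 1)
  | n + 2 => gegenbauerPoly (n + 2) (l + 1) - gegenbauerPoly n (l + 1)

theorem mk_zonalPoly (l : ℝ) :
    PowerSeries.mk (zonalPoly l) = (1 - PowerSeries.X ^ 2) * gegenbauerSeries (l + 1) := by
  ext1 n
  rw [sub_mul, one_mul, map_sub, pow_two, mul_assoc, PowerSeries.coeff_mk]
  match n with
  | 0 => simp [zonalPoly, gegenbauerSeries, gegenbauerPoly]
  | 1 => simp [zonalPoly, gegenbauerSeries, ← mul_assoc, ← pow_two, PowerSeries.coeff_X_pow_mul']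
  | n + 2 => simp [zonalPoly, gegenbauerSeries, PowerSeries.coeff_succ_X_mul]

theorem derivative_zonalPoly (l : ℝ) (n : ℕ) :
    derivative (zonalPoly l (n + 1)) = C (2 * (l + 1)) * zonalPoly (l + 1) n := by
  match n with
  | 0 => simp [zonalPoly, gegenbauerPoly]
  | 1 =>
    simp only [zonalPoly, derivative_sub, derivative_gegenbauerPoly]
    simp [gegenbauerPoly]
  | n + 2 => simp only [zonalPoly, derivative_sub, derivative_gegenbauerPoly, mul_sub]

theorem coeff_X_mul_derivative {R : Type*} [CommRing R] (F : PowerSeries R) (n : ℕ) :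
    PowerSeries.coeff n (PowerSeries.X * PowerSeries.derivative R F) =
      n * PowerSeries.coeff n F := by
  cases n with
  | zero => simp
  | succ n =>
    rw [PowerSeries.coeff_succ_X_mul, PowerSeries.coeff_derivative]
    push_cast
    ring

/-- For `s > 0` the zonal polynomial is a multiple of the Gegenbauer polynomial. -/
theorem add_mul_gegenbauerPoly (s : ℝ) (n : ℕ) :
    C (n + s) * gegenbauerPoly n s = C s * zonalPoly s n := by
  -- The operator `r d/dr` multiplies the `n`-th coefficient by `n`, so `n + s` becomes `r d/dr +
  -- s`, and `2r(x - r) + (1 - 2xr + r²) = 1 - r²`.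
  have h : PowerSeries.X * PowerSeries.derivative ℝ[X] (gegenbauerSeries s) +
      PowerSeries.C (C s) * gegenbauerSeries s =
      PowerSeries.C (C s) * PowerSeries.mk (zonalPoly s) := by
    rw [mk_zonalPoly, derivative_gegenbauerSeries, ← gegenbauerSeries_add_one s]
    simp only [map_mul, map_ofNat]
    ring
  have h' := congrArg (PowerSeries.coeff n) h
  rw [map_add, coeff_X_mul_derivative, PowerSeries.coeff_C_mul, PowerSeries.coeff_C_mul,
    PowerSeries.coeff_mk, gegenbauerSeries, PowerSeries.coeff_mk] at h'
  rw [← h', C_add]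
  simp
  ring

/-- The operator on the left is `(1-x²)^(1/2-l) d/dx (1-x²)^(l+1/2)`, minus the adjoint of `d/dx`
between the weights of parameters `l` and `l + 1`, up to normalization. With `derivative_zonalPoly`
it gives the Gegenbauer equation, whence the eigenvalue `(n+1)(n+1+2l)`. -/
theorem zonalPoly_ladder (l : ℝ) (n : ℕ) :
    C (2 * (l + 1)) * ((1 - X ^ 2) * derivative (zonalPoly (l + 1) n) -
      C (2 * l + 1) * (X * zonalPoly (l + 1) n)) =
      -C ((n + 1) * (n + 1 + 2 * l)) * zonalPoly l (n + 1) := by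
  have hd : PowerSeries.mk (fun n => derivative (zonalPoly (l + 1) n)) =
      PowerSeries.C (C (2 * (l + 2))) * (PowerSeries.X * PowerSeries.mk (zonalPoly (l + 2))) := by
    ext1 n
    rw [PowerSeries.coeff_mk, PowerSeries.coeff_C_mul]
    cases n with
    | zero => simp [zonalPoly]
    | succ n =>
      rw [PowerSeries.coeff_succ_X_mul, PowerSeries.coeff_mk, derivative_zonalPoly]
      ring_nf
  have h2 : PowerSeries.derivative ℝ[X] (2 : PowerSeries ℝ[X]) = 0 := by
    rw [← map_ofNat (PowerSeries.C (R := ℝ[X])) 2, PowerSeries.derivative_C]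
  -- On generating series the eigenvalue `m (m + 2l)` becomes `θ² + 2lθ` with `θ = r d/dr`; after
  -- the extra factor `r` on the left, the coefficient of index `n + 1` is the claim.
  have key : PowerSeries.C (C (2 * (l + 1))) * (PowerSeries.X *
      (PowerSeries.C (1 - X ^ 2) * PowerSeries.mk (fun n => derivative (zonalPoly (l + 1) n)) -
        PowerSeries.C (C (2 * l + 1) * X) * PowerSeries.mk (zonalPoly (l + 1)))) =
      -(PowerSeries.X * PowerSeries.derivative ℝ[X]
          (PowerSeries.X * PowerSeries.derivative ℝ[X] (PowerSeries.mk (zonalPoly l))) +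
        PowerSeries.C (C (2 * l)) *
          (PowerSeries.X * PowerSeries.derivative ℝ[X] (PowerSeries.mk (zonalPoly l)))) := by
    rw [hd]
    simp only [mk_zonalPoly, map_sub, map_add, map_zero, Derivation.leibniz,
      derivative_gegenbauerSeries, PowerSeries.derivative_one, h2, PowerSeries.derivative_C, PowerSeries.derivative_X,
      smul_eq_mul, pow_two, map_mul, map_one, map_ofNat]
    rw [← gegenbauerSeries_add_one (l + 1), ← gegenbauerSeries_add_one (l + 1 + 1),
      show l + 2 + 1 = l + 1 + 1 + 1 by ring]
    ring
  have h := congrArg (PowerSeries.coeff (n + 1)) key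
  rw [PowerSeries.coeff_C_mul, PowerSeries.coeff_succ_X_mul, map_sub, PowerSeries.coeff_C_mul,
    PowerSeries.coeff_C_mul, PowerSeries.coeff_mk, PowerSeries.coeff_mk, map_neg,
    map_add (PowerSeries.coeff (n + 1)), coeff_X_mul_derivative, PowerSeries.coeff_C_mul, coeff_X_mul_derivative,
    PowerSeries.coeff_mk] at h
  rw [← mul_assoc (C (2 * l + 1)), h]
  simp
  ring

/-! ### Orthogonality of the zonal polynomials -/

/-- Integration by parts with the ladder relation: lowering the degree of the zonal factor by one
costs a derivative of `g` and raises the parameter. Orthogonality and norms both follow by iterating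
this. -/
theorem gegenbauerMean_zonalPoly_succ_mul {l : ℝ} (hl : -1 / 2 < l) (n : ℕ) (g : ℝ[X]) :
    (n + 1) * (n + 1 + 2 * l) * gegenbauerMean l (zonalPoly l (n + 1) * g) =
      (2 * l + 1) * gegenbauerMean (l + 1) (zonalPoly (l + 1) n * derivative g) := by
  have h1 := gegenbauerMean_stein hl (zonalPoly (l + 1) n * g)
  have h2 := gegenbauerMean_one_sub_sq_mul hl (zonalPoly (l + 1) n * derivative g)
  have h3 := congrArg (gegenbauerMean l) (congrArg (· * g) (zonalPoly_ladder l n))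
  have e1 : (1 - X ^ 2) * derivative (zonalPoly (l + 1) n * g) =
      (1 - X ^ 2) * derivative (zonalPoly (l + 1) n) * g +
        (1 - X ^ 2) * (zonalPoly (l + 1) n * derivative g) := by
    rw [derivative_mul]; ring
  have e2 : C (2 * (l + 1)) * ((1 - X ^ 2) * derivative (zonalPoly (l + 1) n) -
      C (2 * l + 1) * (X * zonalPoly (l + 1) n)) * g =
      (2 * (l + 1)) • ((1 - X ^ 2) * derivative (zonalPoly (l + 1) n) * g -
        (2 * l + 1) • (X * (zonalPoly (l + 1) n * g))) := by
    simp only [smul_eq_C_mul]; ring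
  have e3 : -C ((n + 1) * (n + 1 + 2 * l)) * zonalPoly l (n + 1) * g =
      (-((n + 1) * (n + 1 + 2 * l))) • (zonalPoly l (n + 1) * g) := by
    simp only [smul_eq_C_mul, C_neg]; ring
  rw [e1, map_add, h2] at h1
  rw [e2, e3, map_smul, map_smul, map_sub, map_smul] at h3
  simp only [smul_eq_mul] at h3
  have h4 : (2 * l + 1) / (2 * l + 2) * (2 * (l + 1)) = 2 * l + 1 := by
    rw [show 2 * (l + 1) = 2 * l + 2 by ring, div_mul_cancel₀ _ (by linarith)]
  linear_combination h3 - 2 * (l + 1) * h1 +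
    gegenbauerMean (l + 1) (zonalPoly (l + 1) n * derivative g) * h4

theorem gegenbauerMean_zonalPoly_mul_eq_zero {l : ℝ} (hl : -1 / 2 < l) {n : ℕ} {g : ℝ[X]}
    (hg : g.degree < n) : gegenbauerMean l (zonalPoly l n * g) = 0 := by
  induction n generalizing l g with
  | zero =>
    have : g = 0 := by simpa [Nat.WithBot.lt_zero_iff] using hg
    simp [this]
  | succ n ih =>
    have h := gegenbauerMean_zonalPoly_succ_mul hl n g
    have hd : (derivative g).degree < n := by
      refine (degree_lt_iff_coeff_zero _ _).2 fun m hm => ?_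
      rw [coeff_derivative, (degree_lt_iff_coeff_zero _ _).1 hg (m + 1) (by omega), zero_mul]
    rw [ih (by linarith) hd, mul_zero, mul_eq_zero] at h
    have hn : (0 : ℝ) ≤ n := n.cast_nonneg
    refine h.resolve_left (mul_ne_zero (by linarith) (by linarith))

/-- At `x = 1` the derivative term of the ladder relation vanishes, leaving a recursion with
positive factors. -/
theorem eval_one_zonalPoly_pos {l : ℝ} (hl : -1 / 2 < l) (n : ℕ) : 0 < (zonalPoly l n).eval 1 := by
  induction n generalizing l with
  | zero => simp [zonalPoly]
  | succ n ih =>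
    have h := congrArg (eval 1) (zonalPoly_ladder l n)
    have h1 := ih (l := l + 1) (by linarith)
    have hn : (0 : ℝ) ≤ n := n.cast_nonneg
    simp at h
    have h2 : 0 < (n + 1) * (n + 1 + 2 * l) := mul_pos (by linarith) (by linarith)
    have h3 : 0 < 2 * (l + 1) * ((2 * l + 1) * (zonalPoly (l + 1) n).eval 1) :=
      mul_pos (by linarith) (mul_pos (by linarith) h1)
    rw [h] at h3
    exact pos_of_mul_pos_right (by linarith) h2.le

/-- Both sides obey the same recursion in `(l, n)`. That the squared norm is the value at `1`, for
every parameter, is what makes the adjoint of `τ` preserve values at the pole. -/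
theorem gegenbauerMean_zonalPoly_mul_self {l : ℝ} (hl : -1 / 2 < l) (n : ℕ) :
    gegenbauerMean l (zonalPoly l n * zonalPoly l n) = (zonalPoly l n).eval 1 := by
  induction n generalizing l with
  | zero => simp [zonalPoly, gegenbauerMean_one hl]
  | succ n ih =>
    have h := gegenbauerMean_zonalPoly_succ_mul hl n (zonalPoly l (n + 1))
    have hn : (0 : ℝ) ≤ n := n.cast_nonneg
    have h0 : (n + 1) * (n + 1 + 2 * l) ≠ 0 := mul_ne_zero (by linarith) (by linarith)
    have h1 := congrArg (eval 1) (zonalPoly_ladder l n)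
    rw [derivative_zonalPoly, mul_left_comm, ← smul_eq_C_mul, map_smul, ih (by linarith)] at h
    refine mul_left_cancel₀ h0 ?_
    rw [h]
    simp at h1 ⊢
    linear_combination h1

/-! ### Parity spaces and adjoints of maps between zonal families. -/

/-- The polynomials of degree at most `i` with the parity of `i`. -/
def paritySpace (i : ℕ) : Submodule ℝ ℝ[X] where
  carrier := {f | ∀ m, f.coeff m ≠ 0 → ∃ k, m + 2 * k = i}
  add_mem' {f g} hf hg m hm := by
    by_cases h : f.coeff m = 0
    · exact hg m fun h' => hm (by rw [coeff_add, h, h', add_zero])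
    · exact hf m h
  zero_mem' m hm := (hm (coeff_zero m)).elim
  smul_mem' c f hf m hm := hf m fun h => hm (by rw [coeff_smul, h, smul_zero])

theorem X_pow_mem_paritySpace (m k : ℕ) : X ^ m ∈ paritySpace (m + 2 * k) := by
  intro j hj
  rw [coeff_X_pow] at hj
  exact ⟨k, by rw [(ite_ne_right_iff.1 hj).1]⟩

theorem paritySpace_le_iff {i : ℕ} {W : Submodule ℝ ℝ[X]} :
    paritySpace i ≤ W ↔ ∀ m k, m + 2 * k = i → X ^ m ∈ W := by
  refine ⟨fun h m k hm => h (hm ▸ X_pow_mem_paritySpace m k), fun h f hf => ?_⟩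
  rw [f.as_sum_support_C_mul_X_pow]
  refine W.sum_mem fun m hm => ?_
  obtain ⟨k, hk⟩ := hf m (mem_support_iff.1 hm)
  rw [← smul_eq_C_mul]
  exact W.smul_mem _ (h m k hk)

theorem paritySpace_le_add_two (i : ℕ) : paritySpace i ≤ paritySpace (i + 2) :=
  paritySpace_le_iff.2 fun m k h => by
    have := X_pow_mem_paritySpace m (k + 1)
    rwa [show m + 2 * (k + 1) = i + 2 by omega] at this

theorem X_mul_mem_paritySpace {i : ℕ} {f : ℝ[X]} (hf : f ∈ paritySpace i) :
    X * f ∈ paritySpace (i + 1) := by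
  have : paritySpace i ≤ (paritySpace (i + 1)).comap (LinearMap.mulLeft ℝ X) :=
    paritySpace_le_iff.2 fun m k h => by
      have := X_pow_mem_paritySpace (m + 1) k
      rwa [show m + 1 + 2 * k = i + 1 by omega, pow_succ'] at this
  exact this hf

theorem C_mul_mem_paritySpace {i : ℕ} (c : ℝ) {f : ℝ[X]} (hf : f ∈ paritySpace i) :
    C c * f ∈ paritySpace i := by
  rw [← smul_eq_C_mul]
  exact Submodule.smul_mem _ c hf

theorem gegenbauerPoly_mem_paritySpace (n : ℕ) (a : ℝ) : gegenbauerPoly n a ∈ paritySpace n := by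
  induction n using Nat.twoStepInduction generalizing a with
  | zero => simpa [gegenbauerPoly] using X_pow_mem_paritySpace 0 0
  | one => exact C_mul_mem_paritySpace _ (by simpa using X_pow_mem_paritySpace 1 0)
  | more n h0 h1 =>
    exact C_mul_mem_paritySpace _ (Submodule.sub_mem _ (X_mul_mem_paritySpace (h1 _))
      (paritySpace_le_add_two n (h0 _)))

theorem zonalPoly_mem_paritySpace (l : ℝ) (n : ℕ) : zonalPoly l n ∈ paritySpace n := by
  match n with
  | 0 => exact gegenbauerPoly_mem_paritySpace 0 0
  | 1 => exact gegenbauerPoly_mem_paritySpace 1 _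
  | n + 2 =>
    exact Submodule.sub_mem _ (gegenbauerPoly_mem_paritySpace _ _)
      (paritySpace_le_add_two n (gegenbauerPoly_mem_paritySpace _ _))

theorem degree_zonalPoly_lt (l : ℝ) {m n : ℕ} (h : m < n) : (zonalPoly l m).degree < n := by
  refine (degree_lt_iff_coeff_zero _ _).2 fun j hj => ?_
  by_contra hc
  obtain ⟨k, hk⟩ := zonalPoly_mem_paritySpace l m j hc
  omega

theorem gegenbauerMean_zonalPoly_mul_of_ne {l : ℝ} (hl : -1 / 2 < l) {m n : ℕ} (h : m ≠ n) :
    gegenbauerMean l (zonalPoly l m * zonalPoly l n) = 0 := by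
  rcases h.lt_or_gt with h | h
  · rw [mul_comm]
    exact gegenbauerMean_zonalPoly_mul_eq_zero hl (degree_zonalPoly_lt l h)
  · exact gegenbauerMean_zonalPoly_mul_eq_zero hl (degree_zonalPoly_lt l h)

theorem coeff_zonalPoly_ne_zero {l : ℝ} (hl : -1 < l) (n : ℕ) : (zonalPoly l n).coeff n ≠ 0 := by
  induction n generalizing l with
  | zero => simp [zonalPoly]
  | succ n ih =>
    intro h
    have h1 := congrArg (coeff · n) (derivative_zonalPoly l n)
    simp only [coeff_derivative, h, zero_mul, coeff_C_mul] at h1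
    exact mul_ne_zero (by linarith) (ih (by linarith)) h1.symm

/-- The zonal polynomials have exact degree and definite parity, so they are triangular against the
monomials spanning the parity space. -/
theorem paritySpace_le_of_zonalPoly {l : ℝ} (hl : -1 < l) {i : ℕ} {W : Submodule ℝ ℝ[X]}
    (h : ∀ m k, m + 2 * k = i → zonalPoly l m ∈ W) : paritySpace i ≤ W := by
  refine paritySpace_le_iff.2 fun m => ?_
  induction m using Nat.strong_induction_on with
  | _ m ih =>
    intro k hk
    have hz := h m k hk
    have hm : m ∈ (zonalPoly l m).support := mem_support_iff.2 (coeff_zonalPoly_ne_zero hl m)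
    rw [(zonalPoly l m).as_sum_support_C_mul_X_pow, ← Finset.add_sum_erase _ _ hm,
      ← smul_eq_C_mul] at hz
    refine (W.smul_mem_iff (coeff_zonalPoly_ne_zero hl m)).1
      ((W.add_mem_iff_left (W.sum_mem fun j hj => ?_)).1 hz)
    obtain ⟨hjm, hj⟩ := Finset.mem_erase.1 hj
    obtain ⟨k', hk'⟩ := zonalPoly_mem_paritySpace l m j (mem_support_iff.1 hj)
    rw [← smul_eq_C_mul]
    exact W.smul_mem _ (ih j (by omega) (k + k') (by omega))

/-- If `τ` maps the zonal polynomials for `l` to those for `l'`, then the adjoint of `τ` preserves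
parity spaces and values at `1`. -/
theorem exists_adjoint {l l' : ℝ} (hl : -1 / 2 < l) (hl' : -1 / 2 < l') {τ : ℝ[X] →ₗ[ℝ] ℝ[X]}
    (hτ : ∀ n, τ (zonalPoly l n) = zonalPoly l' n) {i : ℕ} {f : ℝ[X]} (hf : f ∈ paritySpace i) :
    ∃ h ∈ paritySpace i, h.eval 1 = f.eval 1 ∧
      ∀ φ, gegenbauerMean l' (f * τ φ) = gegenbauerMean l (h * φ) := by
  let W : Submodule ℝ ℝ[X] :=
    { carrier := {f | ∃ h ∈ paritySpace i, h.eval 1 = f.eval 1 ∧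
        ∀ φ, gegenbauerMean l' (f * τ φ) = gegenbauerMean l (h * φ)}
      add_mem' := by
        rintro f g ⟨h, hh, h1, h2⟩ ⟨k, hk, k1, k2⟩
        exact ⟨h + k, Submodule.add_mem _ hh hk, by simp [h1, k1], fun φ => by
          rw [add_mul, add_mul, map_add, map_add, h2, k2]⟩
      zero_mem' := ⟨0, Submodule.zero_mem _, by simp, by simp⟩
      smul_mem' := by
        rintro c f ⟨h, hh, h1, h2⟩
        exact ⟨c • h, Submodule.smul_mem _ c hh, by simp [h1], fun φ => by
          rw [smul_mul_assoc, smul_mul_assoc, map_smul, map_smul, h2]⟩ }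
  refine paritySpace_le_of_zonalPoly (W := W) (l := l') (by linarith) (fun m k hm => ?_) hf
  have h1 := (eval_one_zonalPoly_pos hl m).ne'
  -- The adjoint image of `zonalPoly l' m` is `zonalPoly l m` times the ratio of squared norms;
  -- since these are the values at `1`, the value at `1` is kept.
  refine ⟨((zonalPoly l' m).eval 1 / (zonalPoly l m).eval 1) • zonalPoly l m,
    Submodule.smul_mem _ _ ?_, ?_, fun φ => ?_⟩
  · refine paritySpace_le_iff.2 (fun j k' hj => ?_) (zonalPoly_mem_paritySpace l m)
    rw [show i = j + 2 * (k + k') by omega]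
    exact X_pow_mem_paritySpace _ _
  · rw [eval_smul, smul_eq_mul, div_mul_cancel₀ _ h1]
  · have hW : ∀ j, paritySpace j ≤ LinearMap.eqLocus
        (gegenbauerMean l' ∘ₗ LinearMap.mulLeft ℝ (zonalPoly l' m) ∘ₗ τ)
        (gegenbauerMean l ∘ₗ LinearMap.mulLeft ℝ
          (((zonalPoly l' m).eval 1 / (zonalPoly l m).eval 1) • zonalPoly l m)) := by
      refine fun j => paritySpace_le_of_zonalPoly (l := l) (by linarith) fun n _ _ => ?_
      simp only [LinearMap.mem_eqLocus, LinearMap.comp_apply, LinearMap.mulLeft_apply, hτ]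
      rw [smul_mul_assoc, map_smul, smul_eq_mul]
      by_cases hmn : m = n
      · subst hmn
        rw [gegenbauerMean_zonalPoly_mul_self hl', gegenbauerMean_zonalPoly_mul_self hl,
          div_mul_cancel₀ _ h1]
      · rw [gegenbauerMean_zonalPoly_mul_of_ne hl' hmn, gegenbauerMean_zonalPoly_mul_of_ne hl hmn,
          mul_zero]
    rw [φ.as_sum_support_C_mul_X_pow]
    refine LinearMap.mem_eqLocus.1 (Submodule.sum_mem _ fun j _ => hW j ?_)
    exact C_mul_mem_paritySpace _ (by simpa using X_pow_mem_paritySpace j 0)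

/-! ### The average relating two families of zonal polynomials -/

/-- `1 - 2xr + r²` is affine in `x`, hence equals `pU + (1-p)V` at `p u + (1-p) z`, and the formula
is the coefficient form of `E (pU + (1-p)V)^(-a-b) = U^(-a) V^(-b)`. The differences of the two
sides, over all positive `(a, b)`, form a family closed under derivation in the sense of
`eq_zero_of_derivative_mem_span`. -/
theorem betaMean_gegenbauerPoly {a b : ℝ} (ha : 0 < a) (hb : 0 < b) (u z : ℝ) (n : ℕ) :
    betaMean a b u z (gegenbauerPoly n (a + b)) = ∑ ij ∈ Finset.HasAntidiagonal.antidiagonal n,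
      (gegenbauerPoly ij.1 a).eval u * (gegenbauerPoly ij.2 b).eval z := by
  let S : ℝ → ℝ → PowerSeries ℝ := fun x a => PowerSeries.map (evalRingHom x) (gegenbauerSeries a)
  have hS : ∀ x a, PowerSeries.derivative ℝ (S x a) =
      PowerSeries.C (2 * a) * ((PowerSeries.C x - PowerSeries.X) * S x (a + 1)) := by
    intro x a
    have h := congrArg (PowerSeries.map (evalRingHom x)) (derivative_gegenbauerSeries a)
    have h' : PowerSeries.derivative ℝ (S x a) =
        PowerSeries.map (evalRingHom x) (PowerSeries.derivative ℝ[X] (gegenbauerSeries a)) := by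
      ext1 n
      simp [S, PowerSeries.coeff_derivative]
    rw [h', h]
    simp [S]
  let F : {ab : ℝ × ℝ // 0 < ab.1 ∧ 0 < ab.2} → PowerSeries ℝ := fun ab =>
    PowerSeries.mk (fun n => betaMean ab.1.1 ab.1.2 u z (gegenbauerPoly n (ab.1.1 + ab.1.2))) -
      S u ab.1.1 * S z ab.1.2
  have key : F ⟨(a, b), ha, hb⟩ = 0 := by
    refine eq_zero_of_derivative_mem_span (fun ab => ?_) ?_ _
    · have h0 : ∀ x a, PowerSeries.constantCoeff (S x a) = 1 := fun x a => by
        rw [← PowerSeries.coeff_zero_eq_constantCoeff_apply, PowerSeries.coeff_map]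
        simp [gegenbauerSeries, gegenbauerPoly]
      simp [F, h0, gegenbauerPoly, betaMean_one ab.2.1 ab.2.2]
    · rintro ⟨⟨a, b⟩, ha, hb⟩
      dsimp only at ha hb
      have ha' : 0 < a + 1 := by linarith
      have hb' : 0 < b + 1 := by linarith
      have hd : PowerSeries.derivative ℝ (PowerSeries.mk
          (fun n => betaMean a b u z (gegenbauerPoly n (a + b)))) =
          PowerSeries.C (2 * a) * ((PowerSeries.C u - PowerSeries.X) * PowerSeries.mk
            (fun n => betaMean (a + 1) b u z (gegenbauerPoly n (a + 1 + b)))) +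
          PowerSeries.C (2 * b) * ((PowerSeries.C z - PowerSeries.X) * PowerSeries.mk
            (fun n => betaMean a (b + 1) u z (gegenbauerPoly n (a + (b + 1))))) := by
        have hab : a + b ≠ 0 := by linarith
        have e1 : a + 1 + b = a + b + 1 := by ring
        have e2 : a + (b + 1) = a + b + 1 := by ring
        ext1 n
        simp only [PowerSeries.coeff_derivative, PowerSeries.coeff_mk, map_add,
          PowerSeries.coeff_C_mul, sub_mul, map_sub, e1, e2]
        cases n with
        | zero =>
          have h := betaMean_X_mul ha hb u z 1
          rw [mul_one, betaMean_one ha' hb, betaMean_one ha hb'] at h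
          simp only [gegenbauerPoly, PowerSeries.coeff_zero_X_mul,
            betaMean_one ha' hb, betaMean_one ha hb']
          rw [← smul_eq_C_mul, map_smul, h]
          simp
          field_simp
        | succ n =>
          simp only [PowerSeries.coeff_succ_X_mul, PowerSeries.coeff_mk]
          have h := congrArg (betaMean a b u z) (gegenbauerPoly_add_two n (a + b))
          rw [← smul_eq_C_mul, ← smul_eq_C_mul, map_smul, map_smul, map_sub,
            betaMean_X_mul ha hb, betaMean_contiguous ha hb u z (gegenbauerPoly n _)] at h
          simp only [smul_eq_mul] at h
          push_cast
          rw [show (n : ℝ) + 1 + 1 = n + 2 by ring, mul_comm, h]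
          field_simp
          ring
      have e : PowerSeries.derivative ℝ (F ⟨(a, b), ha, hb⟩) =
          (PowerSeries.C (2 * a) * (PowerSeries.C u - PowerSeries.X)) * F ⟨(a + 1, b), ha', hb⟩ +
          (PowerSeries.C (2 * b) * (PowerSeries.C z - PowerSeries.X)) *
            F ⟨(a, b + 1), ha, hb'⟩ := by
        simp only [F, map_sub, Derivation.leibniz, hS, hd, smul_eq_mul]
        ring
      rw [e]
      exact Ideal.add_mem _ (Ideal.mul_mem_left _ _ (Ideal.subset_span ⟨_, rfl⟩))
        (Ideal.mul_mem_left _ _ (Ideal.subset_span ⟨_, rfl⟩))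
  have h := congrArg (PowerSeries.coeff n) (sub_eq_zero.1 key)
  rw [PowerSeries.coeff_mk, PowerSeries.coeff_mul] at h
  simpa [S, gegenbauerSeries] using h

theorem gegenbauerMean_gegenbauerPoly {s : ℝ} (hs : 0 < s) (n : ℕ) :
    gegenbauerMean s (gegenbauerPoly n s) = if n = 0 then 1 else 0 := by
  have hs' : -1 / 2 < s := by linarith
  split_ifs with h
  · subst h
    exact gegenbauerMean_one hs'
  · have h1 := congrArg (gegenbauerMean s) (add_mul_gegenbauerPoly s n)
    have h2 := gegenbauerMean_zonalPoly_mul_eq_zero hs' (n := n) (g := 1)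
      (by rw [degree_one]; exact_mod_cast Nat.pos_of_ne_zero h)
    rw [← smul_eq_C_mul, ← smul_eq_C_mul, map_smul, map_smul, ← mul_one (zonalPoly s n), h2,
      smul_zero, smul_eq_zero] at h1
    exact h1.resolve_left (by positivity)

/-- The monomials averaged over `p * x + (1 - p) * z`, with `p` distributed by a beta distribution
and `z` by the weight `(1 - z²)^(s - 1/2)`. -/
def averageMap (l s : ℝ) : ℝ[X] →ₗ[ℝ] ℝ[X] :=
  lsum fun k => LinearMap.toSpanSingleton ℝ ℝ[X] (∑ j ∈ Finset.range (k + 1),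
    C ((∫ p, p ^ j * (1 - p) ^ (k - j) ∂betaMeasure (l + 1) s) *
      gegenbauerMean s (X ^ (k - j)) * k.choose j) * X ^ j)

theorem averageMap_X_pow (l s : ℝ) (k : ℕ) :
    averageMap l s (X ^ k) = ∑ j ∈ Finset.range (k + 1),
    C ((∫ p, p ^ j * (1 - p) ^ (k - j) ∂betaMeasure (l + 1) s) *
      gegenbauerMean s (X ^ (k - j)) * k.choose j) * X ^ j := by
  rw [averageMap, lsum_apply, ← monomial_one_right_eq_X_pow, sum_monomial_index] <;> simp

/-- Odd moments of `z` vanish, so only powers `X ^ j` with `k - j` even survive. -/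
theorem averageMap_X_pow_mem {l s : ℝ} (hs : 0 < s) (k : ℕ) :
    averageMap l s (X ^ k) ∈ paritySpace k := by
  rw [averageMap_X_pow]
  refine Submodule.sum_mem _ fun j hj => ?_
  have hj := Finset.mem_range.1 hj
  rcases Nat.even_or_odd' (k - j) with ⟨i, hi | hi⟩
  · refine C_mul_mem_paritySpace _ ?_
    rw [show k = j + 2 * i by omega]
    exact X_pow_mem_paritySpace _ _
  · rw [hi, gegenbauerMean_X_pow_odd (by linarith), mul_zero, zero_mul, C_0, zero_mul]
    exact Submodule.zero_mem _

theorem measure_prod_compl_null {μ ν : Measure ℝ} [SFinite μ] [SFinite ν] {s t : Set ℝ}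
    (hs : μ sᶜ = 0) (ht : ν tᶜ = 0) : (μ.prod ν) (s ×ˢ t)ᶜ = 0 := by
  rw [compl_prod_eq_union]
  simp [hs, ht]

/-- Binomial expansion and Fubini turn the moments in the definition into an honest double average,
with `z = 1 - 2 q.2`. -/
theorem averageMap_eval {l s : ℝ} (hl : -1 < l) (hs : 0 < s) (φ : ℝ[X]) (x : ℝ) :
    (averageMap l s φ).eval x = ∫ q, φ.eval (q.1 * x + (1 - q.1) * (1 - 2 * q.2))
      ∂(betaMeasure (l + 1) s).prod (betaMeasure (s + 1 / 2) (s + 1 / 2)) := by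
  have hs' : 0 < s + 1 / 2 := by linarith
  have hl' : 0 < l + 1 := by linarith
  have := isProbabilityMeasureBeta hl' hs
  have := isProbabilityMeasureBeta hs' hs'
  have hint : ∀ {f : ℝ × ℝ → ℝ}, Continuous f →
      Integrable f ((betaMeasure (l + 1) s).prod (betaMeasure (s + 1 / 2) (s + 1 / 2))) :=
    fun hf => integrable_of_continuous_of_compl_null (isCompact_Icc.prod isCompact_Icc)
      (measure_prod_compl_null (betaMeasure_compl_Icc _ _) (betaMeasure_compl_Icc _ _)) hf
  induction φ using Polynomial.induction_on' with
  | add p q hp hq =>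
    rw [map_add, eval_add, hp, hq, ← integral_add (hint (by fun_prop)) (hint (by fun_prop))]
    simp
  | monomial k c =>
    rw [← C_mul_X_pow_eq_monomial, ← smul_eq_C_mul, map_smul, eval_smul, averageMap_X_pow,
      eval_finsetSum]
    simp only [eval_smul, smul_eq_mul, eval_pow, eval_X]
    rw [integral_const_mul]
    congr 1
    simp only [add_pow, mul_pow]
    rw [integral_finsetSum _ fun j _ => hint (by fun_prop)]
    refine Finset.sum_congr rfl fun j _ => ?_
    have e : ∀ q : ℝ × ℝ, q.1 ^ j * x ^ j * ((1 - q.1) ^ (k - j) * (1 - 2 * q.2) ^ (k - j)) *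
        k.choose j = k.choose j * x ^ j * ((q.1 ^ j * (1 - q.1) ^ (k - j)) *
          (1 - 2 * q.2) ^ (k - j)) := fun q => by ring
    simp only [e]
    rw [integral_const_mul, integral_prod_mul (fun p : ℝ => p ^ j * (1 - p) ^ (k - j))
      (fun p : ℝ => (1 - 2 * p) ^ (k - j)), gegenbauerMean, betaMean_apply hs' hs']
    simp only [eval_mul, eval_C, eval_pow, eval_X]
    have : ∀ p : ℝ, p * -1 + (1 - p) * 1 = 1 - 2 * p := fun p => by ring
    simp only [this]
    ring

/-- Averaging over `p` splits the polynomial into products `C_i^(l+1)(x) C_j^s(z)`; averaging over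
`z` kills all terms with `j ≥ 1`. -/
theorem averageMap_gegenbauerPoly {l s : ℝ} (hl : -1 < l) (hs : 0 < s) (n : ℕ) :
    averageMap l s (gegenbauerPoly n (l + 1 + s)) = gegenbauerPoly n (l + 1) := by
  have hs' : 0 < s + 1 / 2 := by linarith
  have hl' : 0 < l + 1 := by linarith
  have := isProbabilityMeasureBeta hl' hs
  have := isProbabilityMeasureBeta hs' hs'
  refine Polynomial.funext fun x => ?_
  rw [averageMap_eval hl hs, integral_prod_symm]
  · simp only
    have h1 : ∀ z : ℝ, ∫ p, (gegenbauerPoly n (l + 1 + s)).eval (p * x + (1 - p) * (1 - 2 * z))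
        ∂betaMeasure (l + 1) s = ∑ ij ∈ Finset.HasAntidiagonal.antidiagonal n,
      (gegenbauerPoly ij.1 (l + 1)).eval x * (gegenbauerPoly ij.2 s).eval (1 - 2 * z) := fun z => by
      rw [← betaMean_apply hl' hs, betaMean_gegenbauerPoly hl' hs]
    simp only [h1]
    rw [integral_finsetSum _ fun j _ => integrable_betaMeasure hs' hs' (by fun_prop)]
    have h2 : ∀ j, ∫ z, (gegenbauerPoly j s).eval (1 - 2 * z) ∂betaMeasure (s + 1 / 2) (s + 1 / 2) =
        if j = 0 then 1 else 0 := fun j => by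
      rw [← gegenbauerMean_gegenbauerPoly hs, gegenbauerMean, betaMean_apply hs' hs']
      congr 1
      ext z
      congr 1
      ring
    simp only [integral_const_mul, h2]
    rw [Finset.sum_eq_single (n, 0)]
    · simp
    · rintro ⟨i, j⟩ hij hne
      have : j ≠ 0 := by
        rintro rfl
        exact hne (by simpa using hij)
      simp [this]
    · simp
  · exact integrable_of_continuous_of_compl_null (isCompact_Icc.prod isCompact_Icc)
      (measure_prod_compl_null (betaMeasure_compl_Icc _ _) (betaMeasure_compl_Icc _ _))
      (by fun_prop)

/-- Zonal polynomials are differences of Gegenbauer polynomials of the next parameter; using `l + 1`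
instead of `l` keeps the case `l = 0`, that is `d = 2`, regular. -/
theorem averageMap_zonalPoly {l s : ℝ} (hl : -1 < l) (hs : 0 < s) (n : ℕ) :
    averageMap l s (zonalPoly (l + s) n) = zonalPoly l n := by
  have e : l + s + 1 = l + 1 + s := by ring
  match n with
  | 0 => exact averageMap_gegenbauerPoly hl hs 0
  | 1 =>
    rw [zonalPoly, zonalPoly, e]
    exact averageMap_gegenbauerPoly hl hs 1
  | n + 2 =>
    rw [zonalPoly, zonalPoly, e, map_sub, averageMap_gegenbauerPoly hl hs,
      averageMap_gegenbauerPoly hl hs]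

/-! ### Moments of the sphere -/

/-- The normalized surface measure of the unit sphere of `ℝ^d`. -/
def sphereProb (d : ℕ) : Measure (Metric.sphere (0 : EuclideanSpace ℝ (Fin d)) 1) :=
  ((volume : Measure (EuclideanSpace ℝ (Fin d))).toSphere univ)⁻¹ •
    (volume : Measure (EuclideanSpace ℝ (Fin d))).toSphere

instance (d : ℕ) [NeZero d] : IsProbabilityMeasure (sphereProb d) := by
  have : NeZero (volume : Measure (EuclideanSpace ℝ (Fin d))).toSphere :=
    ⟨Measure.toSphere_ne_zero _⟩
  exact isProbabilityMeasureSMul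

theorem integrable_sphereProb {d : ℕ} [NeZero d]
    {f : Metric.sphere (0 : EuclideanSpace ℝ (Fin d)) 1 → ℝ} (hf : Continuous f) :
    Integrable f (sphereProb d) :=
  integrable_of_continuous_of_compl_null isCompact_univ (by simp) hf

/-- The radial part of the Gaussian integral of a function that is homogeneous of degree `j`. -/
def radialMoment (d j : ℕ) : ℝ :=
  ((volume : Measure (EuclideanSpace ℝ (Fin d))).toSphere univ).toReal *
    ∫ r : Ioi (0 : ℝ), (r : ℝ) ^ j * Real.exp (-(r : ℝ) ^ 2) ∂Measure.volumeIoiPow (d - 1)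

/-- In polar coordinates the radial factor depends on the degree alone. Sphere integrals thereby
inherit from the Gaussian its product structure and its invariance under isometries. -/
theorem integral_gaussian_of_homogeneous {d : ℕ} [NeZero d] {j : ℕ}
    {F : EuclideanSpace ℝ (Fin d) → ℝ} (hF : ∀ r : ℝ, ∀ x, F (r • x) = r ^ j * F x) :
    ∫ x, F x * Real.exp (-‖x‖ ^ 2) = radialMoment d j * ∫ η, F η ∂sphereProb d := by
  set μ : Measure (EuclideanSpace ℝ (Fin d)) := volume
  have hne : μ.toSphere univ ≠ 0 := by
    rw [Ne, Measure.measure_univ_eq_zero]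
    exact Measure.toSphere_ne_zero _
  calc
    ∫ x, F x * Real.exp (-‖x‖ ^ 2) ∂μ
        = ∫ x : ({0}ᶜ : Set (EuclideanSpace ℝ (Fin d))),
          F x.1 * Real.exp (-‖x.1‖ ^ 2) ∂(μ.comap (↑)) := by
      rw [integral_subtype_comap (measurableSet_singleton _).compl
        fun x ↦ F x * Real.exp (-‖x‖ ^ 2), restrict_compl_singleton]
    _ = ∫ p, F p.1 * ((p.2 : ℝ) ^ j * Real.exp (-(p.2 : ℝ) ^ 2))
          ∂μ.toSphere.prod (.volumeIoiPow (d - 1)) := by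
      have h := μ.measurePreserving_homeomorphUnitSphereProd.integral_comp
        (Homeomorph.measurableEmbedding _) (fun p : Metric.sphere (0 : EuclideanSpace ℝ (Fin d)) 1 ×
          Ioi (0 : ℝ) => F p.1 * ((p.2 : ℝ) ^ j * Real.exp (-(p.2 : ℝ) ^ 2)))
      rw [finrank_euclideanSpace_fin] at h
      rw [← h]
      congr 1
      ext x
      have hx : ‖x.1‖ ≠ 0 := norm_ne_zero_iff.2 x.2
      simp only [homeomorphUnitSphereProd_apply_fst_coe, homeomorphUnitSphereProd_apply_snd_coe]
      rw [hF, ← mul_assoc, mul_right_comm _ (F x.1), inv_pow, inv_mul_cancel₀ (pow_ne_zero _ hx),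
        one_mul]
    _ = _ := by
      rw [integral_prod_mul (fun η : Metric.sphere (0 : EuclideanSpace ℝ (Fin d)) 1 => F η)
        (fun r : Ioi (0 : ℝ) => (r : ℝ) ^ j * Real.exp (-(r : ℝ) ^ 2)), radialMoment, sphereProb,
        integral_smul_measure, smul_eq_mul, ENNReal.toReal_inv]
      have : ((volume : Measure (EuclideanSpace ℝ (Fin d))).toSphere univ).toReal ≠ 0 :=
        ENNReal.toReal_ne_zero.2 ⟨hne, measure_ne_top _ _⟩
      field_simp
      exact mul_comm _ _

theorem radialMoment_eq {d : ℕ} [NeZero d] (j : ℕ) :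
    radialMoment d j = ((volume : Measure (EuclideanSpace ℝ (Fin d))).toSphere univ).toReal *
      (1 / 2 * Real.Gamma ((d + j) / 2)) := by
  have hd : 0 < d := Nat.pos_of_ne_zero (NeZero.ne d)
  rw [radialMoment]
  congr 1
  simp only [Measure.volumeIoiPow, ENNReal.ofReal]
  rw [integral_withDensity_eq_integral_smul (measurable_subtype_coe.pow_const _).real_toNNReal,
    integral_subtype_comap measurableSet_Ioi
      fun a : ℝ ↦ Real.toNNReal (a ^ (d - 1)) • (a ^ j * Real.exp (-a ^ 2))]
  have h := integral_rpow_mul_exp_neg_rpow (p := 2) (q := (d - 1 : ℕ) + j) (by norm_num) (by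
    have : (0 : ℝ) ≤ (d - 1 : ℕ) + j := by positivity
    linarith)
  rw [show ((d - 1 : ℕ) + j + 1 : ℝ) / 2 = (d + j) / 2 by rw [Nat.cast_pred hd]; ring] at h
  rw [← h]
  refine setIntegral_congr_fun measurableSet_Ioi fun x hx => ?_
  have hx : 0 < x := hx
  simp only [NNReal.smul_def, smul_eq_mul]
  rw [Real.coe_toNNReal _ (by positivity), Real.rpow_add hx, Real.rpow_natCast, Real.rpow_natCast,
    Real.rpow_two, mul_assoc]

theorem radialMoment_pos {d : ℕ} [NeZero d] (j : ℕ) : 0 < radialMoment d j := by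
  have hd : 0 < d := Nat.pos_of_ne_zero (NeZero.ne d)
  have hne : (volume : Measure (EuclideanSpace ℝ (Fin d))).toSphere univ ≠ 0 := by
    rw [Ne, Measure.measure_univ_eq_zero]
    exact Measure.toSphere_ne_zero _
  rw [radialMoment_eq]
  refine mul_pos (ENNReal.toReal_pos hne (measure_ne_top _ _))
    (mul_pos (by norm_num) (Real.Gamma_pos_of_pos (by positivity)))

theorem radialMoment_add_two {d : ℕ} [NeZero d] (j : ℕ) :
    radialMoment d (j + 2) = (d + j) / 2 * radialMoment d j := by
  have hd : 0 < d := Nat.pos_of_ne_zero (NeZero.ne d)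
  rw [radialMoment_eq, radialMoment_eq,
    show ((d : ℝ) + (j + 2 : ℕ)) / 2 = (d + j) / 2 + 1 by push_cast; ring,
    Real.Gamma_add_one (by positivity)]
  ring

theorem integral_sphereProb_comp_isometry {d : ℕ} [NeZero d] {j : ℕ}
    {F : EuclideanSpace ℝ (Fin d) → ℝ} (hF : ∀ r : ℝ, ∀ x, F (r • x) = r ^ j * F x)
    (ρ : EuclideanSpace ℝ (Fin d) ≃ₗᵢ[ℝ] EuclideanSpace ℝ (Fin d)) :
    ∫ η, F (ρ η) ∂sphereProb d = ∫ η, F η ∂sphereProb d := by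
  have h1 := integral_gaussian_of_homogeneous hF
  have h2 := integral_gaussian_of_homogeneous (F := fun x => F (ρ x)) (j := j) fun r x => by
    rw [map_smul, hF]
  have h3 := ρ.measurePreserving.integral_comp ρ.toHomeomorph.measurableEmbedding
    fun x => F x * Real.exp (-‖x‖ ^ 2)
  simp only [ρ.norm_map] at h3
  rw [← h3, h2] at h1
  exact mul_left_cancel₀ (radialMoment_pos j).ne' h1

/-- The moments of `exp (-x²)`. -/
def gaussianMoment (k : ℕ) : ℝ := ∫ x : ℝ, x ^ k * Real.exp (-x ^ 2)

theorem gaussianMoment_two_mul (k : ℕ) : gaussianMoment (2 * k) = Real.Gamma ((2 * k + 1) / 2) := by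
  have h := integral_rpow_mul_exp_neg_rpow (p := 2) (q := (2 * k : ℕ)) (by norm_num) (by
    have : (0 : ℝ) ≤ (2 * k : ℕ) := by positivity
    linarith)
  have h2 := integral_comp_abs (f := fun x : ℝ => x ^ (2 * k) * Real.exp (-x ^ 2))
  simp only [sq_abs, (even_two_mul k).pow_abs] at h2
  rw [gaussianMoment, h2]
  have h3 : ∫ x in Ioi (0 : ℝ), x ^ (2 * k) * Real.exp (-x ^ 2) =
      ∫ x in Ioi (0 : ℝ), x ^ ((2 * k : ℕ) : ℝ) * Real.exp (-x ^ (2 : ℝ)) :=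
    setIntegral_congr_fun measurableSet_Ioi fun x _ => by
      simp only [Real.rpow_natCast, Real.rpow_two]
  rw [h3, h]
  push_cast
  ring

theorem gaussianMoment_odd (k : ℕ) : gaussianMoment (2 * k + 1) = 0 := by
  have h := integral_neg_eq_self (fun x : ℝ => x ^ (2 * k + 1) * Real.exp (-x ^ 2)) volume
  simp only [neg_sq, (odd_two_mul_add_one k).neg_pow, neg_mul] at h
  rw [integral_neg] at h
  rw [gaussianMoment]
  linarith

theorem gaussianMoment_add_two (k : ℕ) :
    gaussianMoment (k + 2) = (k + 1) / 2 * gaussianMoment k := by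
  obtain ⟨m, rfl | rfl⟩ := Nat.even_or_odd' k
  · rw [show 2 * m + 2 = 2 * (m + 1) by ring, gaussianMoment_two_mul, gaussianMoment_two_mul,
      show (2 * ((m + 1 : ℕ) : ℝ) + 1) / 2 = (2 * m + 1) / 2 + 1 by push_cast; ring,
      Real.Gamma_add_one (by positivity)]
    push_cast
    ring
  · rw [show 2 * m + 1 + 2 = 2 * (m + 1) + 1 by ring, gaussianMoment_odd, gaussianMoment_odd,
      mul_zero]

theorem radialMoment_mul_integral_monomial {d : ℕ} [NeZero d] (κ : Fin d → ℕ) :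
    radialMoment d (∑ i, κ i) *
      ∫ η : Metric.sphere (0 : EuclideanSpace ℝ (Fin d)) 1, ∏ i, η.1 i ^ κ i ∂sphereProb d =
      ∏ i, gaussianMoment (κ i) := by
  rw [← integral_gaussian_of_homogeneous (F := fun x => ∏ i, x i ^ κ i), ←
    (PiLp.volume_preserving_toLp (Fin d)).integral_comp
      (MeasurableEquiv.toLp 2 (Fin d → ℝ)).measurableEmbedding]
  · have : ∀ x : Fin d → ℝ, (∏ i, (WithLp.toLp 2 x) i ^ κ i) * Real.exp (-‖WithLp.toLp 2 x‖ ^ 2) =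
        ∏ i, (x i ^ κ i * Real.exp (-x i ^ 2)) := fun x => by
      rw [EuclideanSpace.real_norm_sq_eq, Finset.prod_mul_distrib, ← Finset.sum_neg_distrib,
        Real.exp_sum]
    simp only [this]
    exact integral_fintype_prod_volume_eq_prod fun i (x : ℝ) => x ^ κ i * Real.exp (-x ^ 2)
  · intro r x
    simp [mul_pow, Finset.prod_mul_distrib, Finset.prod_pow_eq_pow_sum]

/-! ### Averaging homogeneous polynomials about an axis of the sphere. -/

theorem one_sub_sq_pow_mem_paritySpace (m b : ℕ) :
    X ^ m * (1 - X ^ 2) ^ b ∈ paritySpace (m + 2 * b) := by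
  induction b generalizing m with
  | zero => simpa using X_pow_mem_paritySpace m 0
  | succ b ih =>
    rw [show X ^ m * (1 - X ^ 2 : ℝ[X]) ^ (b + 1) =
      X ^ m * (1 - X ^ 2) ^ b - X ^ (m + 2) * (1 - X ^ 2) ^ b by ring]
    refine Submodule.sub_mem _ (paritySpace_le_add_two _ (ih m)) ?_
    have := ih (m + 2)
    rwa [show m + 2 + 2 * b = m + 2 * (b + 1) by ring] at this

theorem exists_gegenbauerMean_one_sub_sq_pow_mul {l : ℝ} (hl : -1 / 2 < l) (b : ℕ) :
    ∃ c > 0, ∀ φ, gegenbauerMean l ((1 - X ^ 2) ^ b * φ) = c * gegenbauerMean (l + b) φ := by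
  induction b with
  | zero => exact ⟨1, one_pos, fun φ => by simp⟩
  | succ b ih =>
    obtain ⟨c, hc, h⟩ := ih
    have hb : (0 : ℝ) ≤ b := b.cast_nonneg
    refine ⟨c * ((2 * (l + b) + 1) / (2 * (l + b) + 2)),
      mul_pos hc (div_pos (by linarith) (by linarith)), fun φ => ?_⟩
    rw [pow_succ, mul_assoc, h, gegenbauerMean_one_sub_sq_mul (by linarith), Nat.cast_succ]
    ring_nf

theorem radialMoment_mul_integral_update {d : ℕ} [NeZero d] (i₀ : Fin d) (κ : Fin d → ℕ) (K : ℕ) :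
    radialMoment d (K + ∑ i ∈ Finset.univ.erase i₀, κ i) *
      ∫ η : Metric.sphere (0 : EuclideanSpace ℝ (Fin d)) 1,
        η.1 i₀ ^ K * ∏ i ∈ Finset.univ.erase i₀, η.1 i ^ κ i ∂sphereProb d =
      gaussianMoment K * ∏ i ∈ Finset.univ.erase i₀, gaussianMoment (κ i) := by
  have h := radialMoment_mul_integral_monomial (Function.update κ i₀ K)
  simp only [← Finset.mul_prod_erase _ _ (Finset.mem_univ i₀),
    ← Finset.add_sum_erase _ _ (Finset.mem_univ i₀), Function.update_self] at h
  have e : ∀ i ∈ Finset.univ.erase i₀, Function.update κ i₀ K i = κ i := fun i hi =>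
    Function.update_of_ne (Finset.ne_of_mem_erase hi) _ _
  rw [Finset.sum_congr rfl e, Finset.prod_congr rfl fun i hi => by rw [e i hi]] at h
  rw [← h]
  congr 2
  ext η
  exact congrArg _ (Finset.prod_congr rfl fun i hi => by rw [e i hi])

/-- On the slice `x i₀ = u` the other coordinates scale like `√(1-u²)`, so a transverse monomial of
degree `2b` contributes `(1-u²)^b`. Formally, both sides satisfy the same two-step recursion in `K`,
and `c` is fixed at `K = 0`. -/
theorem integral_monomial_update {d : ℕ} [NeZero d] (hd : 2 ≤ d) (i₀ : Fin d) (κ : Fin d → ℕ)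
    {b : ℕ} (hb : ∑ i ∈ Finset.univ.erase i₀, κ i = 2 * b) :
    ∃ c, (b = 0 → c = 1) ∧ ∀ K,
      ∫ η : Metric.sphere (0 : EuclideanSpace ℝ (Fin d)) 1,
        η.1 i₀ ^ K * ∏ i ∈ Finset.univ.erase i₀, η.1 i ^ κ i ∂sphereProb d =
      c * gegenbauerMean (((d : ℝ) - 2) / 2) (X ^ K * (1 - X ^ 2) ^ b) := by
  have hd' : (2 : ℝ) ≤ d := by exact_mod_cast hd
  have hl : -1 / 2 < ((d : ℝ) - 2) / 2 := by linarith
  have hlb : -1 / 2 < ((d : ℝ) - 2) / 2 + b := by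
    have : (0 : ℝ) ≤ b := b.cast_nonneg
    linarith
  obtain ⟨c, hc, hN⟩ := exists_gegenbauerMean_one_sub_sq_pow_mul hl b
  have hM := radialMoment_mul_integral_update i₀ κ
  rw [hb] at hM
  set M : ℕ → ℝ := fun K => ∫ η : Metric.sphere (0 : EuclideanSpace ℝ (Fin d)) 1,
    η.1 i₀ ^ K * ∏ i ∈ Finset.univ.erase i₀, η.1 i ^ κ i ∂sphereProb d with hMdef
  have hM : ∀ K, radialMoment d (K + 2 * b) * M K =
      gaussianMoment K * ∏ i ∈ Finset.univ.erase i₀, gaussianMoment (κ i) := hM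
  refine ⟨M 0 / c, fun h => ?_, fun K => ?_⟩
  · subst h
    have h1 := hN 1
    simp only [pow_zero, Nat.cast_zero, add_zero, gegenbauerMean_one hl, mul_one] at h1
    have h2 : ∀ i ∈ Finset.univ.erase i₀, κ i = 0 := by simpa using hb
    have h3 : M 0 = 1 := by
      have h4 : ∀ x : EuclideanSpace ℝ (Fin d),
          x i₀ ^ 0 * ∏ i ∈ Finset.univ.erase i₀, x i ^ κ i = 1 := fun x => by
        rw [pow_zero, one_mul]
        exact Finset.prod_eq_one fun i hi => by rw [h2 i hi, pow_zero]
      simp only [hMdef, h4]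
      simp
    rw [h3, ← h1, div_one]
  · change M K = _
    rw [mul_comm (X ^ K), hN, ← mul_assoc, div_mul_cancel₀ _ hc.ne']
    induction K using Nat.twoStepInduction with
    | zero => rw [pow_zero, gegenbauerMean_one hlb, mul_one]
    | one =>
      have := hM 1
      rw [show gaussianMoment 1 = 0 from gaussianMoment_odd 0, zero_mul, mul_eq_zero] at this
      rw [this.resolve_left (radialMoment_pos _).ne', pow_one, gegenbauerMean_X hlb, mul_zero]
    | more K ih _ =>
      have h1 := hM (K + 2)
      have h2 := hM K
      have h3 := gegenbauerMean_X_pow_add_two hlb K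
      rw [gaussianMoment_add_two, mul_assoc, ← h2, show K + 2 + 2 * b = K + 2 * b + 2 by ring,
        radialMoment_add_two, ih] at h1
      have hr := (radialMoment_pos (d := d) (K + 2 * b)).ne'
      have hK : (K : ℝ) + 2 + 2 * (((d : ℝ) - 2) / 2 + b) ≠ 0 := by
        have : (0 : ℝ) ≤ K := K.cast_nonneg
        linarith
      refine mul_left_cancel₀ (mul_ne_zero hr hK) ?_
      push_cast at h1
      linear_combination 2 * h1 - radialMoment d (K + 2 * b) * M 0 * h3

theorem eval_smul_of_isHomogeneous {σ R : Type*} [CommSemiring R]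
    {P : MvPolynomial σ R} {n : ℕ} (hP : P.IsHomogeneous n) (r : R) (x : σ → R) :
    MvPolynomial.eval (r • x) P = r ^ n * MvPolynomial.eval x P := by
  rw [MvPolynomial.eval_eq, MvPolynomial.eval_eq, Finset.mul_sum]
  refine Finset.sum_congr rfl fun κ hκ => ?_
  simp only [Pi.smul_apply, smul_eq_mul, mul_pow, Finset.prod_mul_distrib]
  rw [Finset.prod_pow_eq_pow_sum, hP.degree_eq_sum_deg_support hκ]
  ring

theorem exists_zonal_projection_of_single {d : ℕ} [NeZero d] (hd : 2 ≤ d) (i₀ : Fin d) {i : ℕ}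
    {P : MvPolynomial (Fin d) ℝ} (hP : P.IsHomogeneous i) :
    ∃ h ∈ paritySpace i,
      h.eval 1 = MvPolynomial.eval (EuclideanSpace.single i₀ (1 : ℝ) : Fin d → ℝ) P ∧
      ∀ k, ∫ η : Metric.sphere (0 : EuclideanSpace ℝ (Fin d)) 1,
        MvPolynomial.eval (η.1 : Fin d → ℝ) P * η.1 i₀ ^ k ∂sphereProb d =
        gegenbauerMean (((d : ℝ) - 2) / 2) (h * X ^ k) := by
  have key : ∀ κ : Fin d →₀ ℕ, ∃ h : ℝ[X], κ.degree = i → h ∈ paritySpace i ∧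
      h.eval 1 = MvPolynomial.eval (EuclideanSpace.single i₀ (1 : ℝ) : Fin d → ℝ)
        (MvPolynomial.monomial κ 1) ∧
      ∀ k, ∫ η : Metric.sphere (0 : EuclideanSpace ℝ (Fin d)) 1,
        MvPolynomial.eval (η.1 : Fin d → ℝ) (MvPolynomial.monomial κ 1) * η.1 i₀ ^ k
          ∂sphereProb d = gegenbauerMean (((d : ℝ) - 2) / 2) (h * X ^ k) := by
    intro κ
    have hev : ∀ x : Fin d → ℝ, MvPolynomial.eval x (MvPolynomial.monomial κ 1) =
        x i₀ ^ κ i₀ * ∏ i ∈ Finset.univ.erase i₀, x i ^ κ i := fun x => by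
      rw [Finset.mul_prod_erase _ (fun i => x i ^ κ i) (Finset.mem_univ i₀),
        MvPolynomial.eval_monomial, one_mul, Finsupp.prod_fintype _ _ fun _ => pow_zero _]
    have hev' : ∀ k (x : Fin d → ℝ), MvPolynomial.eval x (MvPolynomial.monomial κ 1) * x i₀ ^ k =
        x i₀ ^ (κ i₀ + k) * ∏ i ∈ Finset.univ.erase i₀, x i ^ κ i := fun k x => by
      rw [hev]; ring
    have hsingle : ∑ i ∈ Finset.univ.erase i₀, κ i ≠ 0 →
        MvPolynomial.eval (EuclideanSpace.single i₀ (1 : ℝ) : Fin d → ℝ)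
          (MvPolynomial.monomial κ 1) = 0 := fun h => by
      obtain ⟨j, hj, hj0⟩ := Finset.exists_ne_zero_of_sum_ne_zero h
      rw [hev, Finset.prod_eq_zero hj, mul_zero]
      simp [Finset.ne_of_mem_erase hj, hj0]
    have hdeg : κ.degree = κ i₀ + ∑ i ∈ Finset.univ.erase i₀, κ i := by
      rw [Finset.add_sum_erase _ _ (Finset.mem_univ i₀), Finsupp.degree_eq_sum]
    by_cases hA : ∃ j ∈ Finset.univ.erase i₀, Odd (κ j)
    -- An odd transverse exponent makes both the integral and the value at the pole vanish.
    · obtain ⟨j, hj, m, hm⟩ := hA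
      refine ⟨0, fun _ => ⟨Submodule.zero_mem _, ?_, fun k => ?_⟩⟩
      · rw [eval_zero, hsingle]
        intro h
        have := (Finset.sum_eq_zero_iff.1 h) j hj
        omega
      · have h := radialMoment_mul_integral_update i₀ κ (κ i₀ + k)
        rw [Finset.prod_eq_zero hj (by rw [hm, gaussianMoment_odd]), mul_zero, mul_eq_zero] at h
        simp only [hev']
        rw [h.resolve_left (radialMoment_pos _).ne', zero_mul, map_zero]
    · push Not at hA
      obtain ⟨b, hb⟩ : 2 ∣ ∑ i ∈ Finset.univ.erase i₀, κ i :=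
        Finset.dvd_sum fun j hj => (Nat.not_odd_iff_even.1 (hA j hj)).two_dvd
      obtain ⟨c, hc, h⟩ := integral_monomial_update hd i₀ κ hb
      -- At `1` this vanishes unless `b = 0`, where `c = 1`, exactly as the monomial does at the
      -- pole.
      refine ⟨C c * (X ^ κ i₀ * (1 - X ^ 2) ^ b), fun hi => ⟨C_mul_mem_paritySpace _ ?_, ?_,
        fun k => ?_⟩⟩
      · rw [← hi, hdeg, hb]
        exact one_sub_sq_pow_mem_paritySpace _ _
      · by_cases hb0 : b = 0
        · have h2 : ∀ i ∈ Finset.univ.erase i₀, κ i = 0 := by simpa [hb0] using hb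
          rw [hev, Finset.prod_eq_one fun i hi => by rw [h2 i hi, pow_zero], hc hb0, hb0]
          simp
        · rw [hsingle (by omega)]
          simp [hb0]
      · simp only [hev']
        rw [h, mul_assoc, ← smul_eq_C_mul, map_smul, smul_eq_mul]
        congr 2
        ring
  choose h hh using key
  refine ⟨∑ κ ∈ P.support, C (P.coeff κ) * h κ, Submodule.sum_mem _ fun κ hκ =>
    C_mul_mem_paritySpace _ (hh κ (hP.degree_eq_sum_deg_support hκ).symm).1, ?_, fun k => ?_⟩
  · conv_rhs => rw [P.as_sum]
    rw [eval_finsetSum, map_sum]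
    refine Finset.sum_congr rfl fun κ hκ => ?_
    rw [eval_mul, eval_C, (hh κ (hP.degree_eq_sum_deg_support hκ).symm).2.1,
      MvPolynomial.eval_monomial, MvPolynomial.eval_monomial, one_mul]
  · have hP' : ∀ x : Fin d → ℝ, MvPolynomial.eval x P * x i₀ ^ k = ∑ κ ∈ P.support,
        P.coeff κ * (MvPolynomial.eval x (MvPolynomial.monomial κ 1) * x i₀ ^ k) := fun x => by
      conv_lhs => rw [P.as_sum]
      rw [map_sum, Finset.sum_mul]
      refine Finset.sum_congr rfl fun κ hκ => ?_
      rw [MvPolynomial.eval_monomial, MvPolynomial.eval_monomial, one_mul, mul_assoc]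
    simp only [hP']
    rw [integral_finsetSum _ fun κ _ => integrable_sphereProb ?_, Finset.sum_mul, map_sum]
    · refine Finset.sum_congr rfl fun κ hκ => ?_
      rw [integral_const_mul, (hh κ (hP.degree_eq_sum_deg_support hκ).symm).2.2, mul_assoc,
        ← smul_eq_C_mul, map_smul, smul_eq_mul]
    · have := MvPolynomial.continuous_eval (MvPolynomial.monomial κ (1 : ℝ))
      fun_prop

/-- On homogeneous polynomials, integration over the sphere against functions of the inner product
with `ξ` is given by a polynomial in one variable that has the same value at the pole `ξ`. -/
theorem exists_zonal_projection {d : ℕ} [NeZero d] (hd : 2 ≤ d)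
    (ξ : Metric.sphere (0 : EuclideanSpace ℝ (Fin d)) 1) {i : ℕ}
    {P : MvPolynomial (Fin d) ℝ} (hP : P.IsHomogeneous i) :
    ∃ h ∈ paritySpace i, h.eval 1 = MvPolynomial.eval (ξ.1 : Fin d → ℝ) P ∧
      ∀ φ : ℝ[X], ∫ η : Metric.sphere (0 : EuclideanSpace ℝ (Fin d)) 1,
        MvPolynomial.eval (η.1 : Fin d → ℝ) P * φ.eval (inner ℝ ξ.1 η.1) ∂sphereProb d =
        gegenbauerMean (((d : ℝ) - 2) / 2) (h * φ) := by
  have hξ : ‖ξ.1‖ = 1 := by simp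
  let i₀ : Fin d := 0
  let e₀ : EuclideanSpace ℝ (Fin d) := EuclideanSpace.single i₀ 1
  -- A reflection moves the coordinate axis to `ξ`; `P'` below is `P` composed with it, still
  -- homogeneous of degree `i`.
  obtain ⟨ρ, hρ⟩ : ∃ ρ : EuclideanSpace ℝ (Fin d) ≃ₗᵢ[ℝ] EuclideanSpace ℝ (Fin d), ρ e₀ = ξ.1 :=
    ⟨_, Submodule.reflection_sub (by simp [e₀, hξ])⟩
  let P' : MvPolynomial (Fin d) ℝ := MvPolynomial.aeval
    (fun j => ∑ m, MvPolynomial.C (ρ (EuclideanSpace.single m 1) j) * MvPolynomial.X m) P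
  have hP' : P'.IsHomogeneous i := by
    simpa using hP.aeval (n := 1) _ fun j => MvPolynomial.IsHomogeneous.sum _ _ _ fun m _ =>
      MvPolynomial.isHomogeneous_C_mul_X _ _
  have hev : ∀ x : EuclideanSpace ℝ (Fin d), MvPolynomial.eval (x : Fin d → ℝ) P' =
      MvPolynomial.eval (ρ x : Fin d → ℝ) P := by
    intro x
    have hx : ρ x = ∑ m, x m • ρ (EuclideanSpace.single m 1) := by
      simp only [← map_smul, ← map_sum]
      congr 1
      ext j
      simp [Finset.sum_apply, Pi.single_apply]
    rw [← MvPolynomial.coe_aeval_eq_eval, ← MvPolynomial.coe_aeval_eq_eval]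
    change MvPolynomial.aeval _ (MvPolynomial.aeval _ P) = MvPolynomial.aeval _ P
    rw [MvPolynomial.comp_aeval_apply]
    congr 2
    ext j
    simp [hx, mul_comm]
  obtain ⟨h, hh, h1, h2⟩ := exists_zonal_projection_of_single hd i₀ hP'
  refine ⟨h, hh, ?_, fun φ => ?_⟩
  · rw [h1, ← hρ]
    exact hev e₀
  · induction φ using Polynomial.induction_on' with
    | add p q hp hq =>
      have := MvPolynomial.continuous_eval P
      rw [mul_add, map_add, ← hp, ← hq, ← integral_add (integrable_sphereProb (by fun_prop))
        (integrable_sphereProb (by fun_prop))]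
      simp only [eval_add, mul_add]
    | monomial k c =>
      have h3 := integral_sphereProb_comp_isometry (j := i + k)
        (F := fun x : EuclideanSpace ℝ (Fin d) => MvPolynomial.eval (x : Fin d → ℝ) P *
          inner ℝ ξ.1 x ^ k) (fun r x => by
            simp only [inner_smul_right, WithLp.ofLp_smul, eval_smul_of_isHomogeneous hP]
            ring) ρ
      have h4 : ∀ x : EuclideanSpace ℝ (Fin d), inner ℝ ξ.1 (ρ x) = x i₀ := fun x => by
        rw [← hρ, ρ.inner_map_map]
        simp [e₀, EuclideanSpace.inner_single_left]
      simp only [h4, ← hev] at h3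
      rw [h2] at h3
      have h5 : ∀ x y : ℝ, x * (monomial k c).eval y = c * (x * y ^ k) := fun x y => by
        rw [eval_monomial]; ring
      simp only [h5]
      rw [integral_const_mul, ← h3, ← C_mul_X_pow_eq_monomial, mul_left_comm, ← smul_eq_C_mul,
        map_smul, smul_eq_mul]

/-! ### The weights as images of beta distributions -/

theorem lintegral_comp_sub_mul {g : ℝ → ENNReal} (hg : Measurable g) {c : ℝ} (hc : 0 < c) (e : ℝ) :
    ∫⁻ v, g v = ENNReal.ofReal c * ∫⁻ p, g (e - c * p) := by
  rw [← lintegral_sub_left_eq_self g e]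
  conv_lhs => rw [← Real.smul_map_volume_mul_left hc.ne']
  rw [lintegral_smul_measure, abs_of_pos hc, lintegral_map (by fun_prop) (by fun_prop),
    smul_eq_mul]

/-- The beta density is cut off at the endpoints, whereas the real powers in the weights need not
vanish there (`0 ^ 0 = 1`), so densities are compared off these two points. -/
theorem ae_ne_zero_and_ne_one : ∀ᵐ p : ℝ, p ≠ 0 ∧ p ≠ 1 := by
  filter_upwards [compl_mem_ae_iff.2 (measure_singleton (0 : ℝ)),
    compl_mem_ae_iff.2 (measure_singleton (1 : ℝ))] with p h0 h1 using ⟨h0, h1⟩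

theorem measurable_betaPDF (a b : ℝ) : Measurable (betaPDF a b) :=
  (measurable_betaPDFReal a b).ennreal_ofReal

theorem mul_betaPDFReal {a b p : ℝ} (ha : -1 < a) (hb : -1 < b) (h0 : 0 < p) (h1 : p < 1) :
    beta (a + 1) (b + 1) * betaPDFReal (a + 1) (b + 1) p = p ^ a * (1 - p) ^ b := by
  have h := (beta_pos (α := a + 1) (β := b + 1) (by linarith) (by linarith)).ne'
  rw [betaPDFReal, if_pos ⟨h0, h1⟩, add_sub_cancel_right, add_sub_cancel_right]
  field_simp

theorem withDensity_restrict_Icc_zero_one {a b : ℝ} (ha : -1 < a) (hb : -1 < b) :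
    (volume.restrict (Icc 0 1)).withDensity (fun s : ℝ => ENNReal.ofReal (s ^ a * (1 - s) ^ b)) =
      ENNReal.ofReal (beta (a + 1) (b + 1)) • betaMeasure (a + 1) (b + 1) := by
  have hB := beta_pos (α := a + 1) (β := b + 1) (by linarith) (by linarith)
  rw [betaMeasure, ← withDensity_smul _ (measurable_betaPDF _ _),
    ← withDensity_indicator measurableSet_Icc]
  refine withDensity_congr_ae ?_
  filter_upwards [ae_ne_zero_and_ne_one] with p hp
  rw [Pi.smul_apply, smul_eq_mul, betaPDF, ← ENNReal.ofReal_mul hB.le]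
  by_cases h : p ∈ Icc (0 : ℝ) 1
  · rw [indicator_of_mem h, mul_betaPDFReal ha hb (h.1.lt_of_ne hp.1.symm) (h.2.lt_of_ne hp.2)]
  · rw [indicator_of_notMem h, betaPDFReal, if_neg fun h' => h ⟨h'.1.le, h'.2.le⟩, mul_zero,
      ENNReal.ofReal_zero]

theorem withDensity_restrict_Icc_neg_one_one {a b : ℝ} (ha : -1 < a) (hb : -1 < b) :
    (volume.restrict (Icc (-1) 1)).withDensity
        (fun z : ℝ => ENNReal.ofReal ((1 - z) ^ a * (1 + z) ^ b)) =
      ENNReal.ofReal (2 ^ (a + b + 1) * beta (a + 1) (b + 1)) •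
        (betaMeasure (a + 1) (b + 1)).map fun p => 1 - 2 * p := by
  have hB := beta_pos (α := a + 1) (β := b + 1) (by linarith) (by linarith)
  have hm : Measurable fun z : ℝ => ENNReal.ofReal ((1 - z) ^ a * (1 + z) ^ b) := by fun_prop
  ext A hA
  rw [← withDensity_indicator measurableSet_Icc, withDensity_apply _ hA,
    ← lintegral_indicator hA, lintegral_comp_sub_mul
      ((hm.indicator measurableSet_Icc).indicator hA) two_pos 1, Measure.smul_apply,
    Measure.map_apply (by fun_prop) hA, betaMeasure,
    withDensity_apply _ (hA.preimage (by fun_prop)),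
    ← lintegral_indicator (hA.preimage (by fun_prop)), smul_eq_mul,
    ← lintegral_const_mul' _ _ ENNReal.ofReal_ne_top,
    ← lintegral_const_mul' _ _ ENNReal.ofReal_ne_top]
  refine lintegral_congr_ae ?_
  filter_upwards [ae_ne_zero_and_ne_one] with p hp
  by_cases hpA : 1 - 2 * p ∈ A
  · rw [indicator_of_mem hpA, indicator_of_mem (show p ∈ (fun p : ℝ => 1 - 2 * p) ⁻¹' A from hpA)]
    by_cases h : p ∈ Icc (0 : ℝ) 1
    · have h0 := h.1.lt_of_ne hp.1.symm
      have h1 := h.2.lt_of_ne hp.2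
      rw [indicator_of_mem (show 1 - 2 * p ∈ Icc (-1 : ℝ) 1 from ⟨by linarith, by linarith⟩),
        betaPDF, ← ENNReal.ofReal_mul two_pos.le,
        ← ENNReal.ofReal_mul (by positivity), mul_assoc, mul_betaPDFReal ha hb h0 h1,
        show 1 - (1 - 2 * p) = 2 * p by ring, show 1 + (1 - 2 * p) = 2 * (1 - p) by ring,
        Real.mul_rpow two_pos.le h0.le, Real.mul_rpow two_pos.le (by linarith),
        Real.rpow_add_one two_ne_zero, Real.rpow_add two_pos]
      congr 1
      ring
    · rw [indicator_of_notMem fun h' => h ⟨by linarith [h'.2], by linarith [h'.1]⟩, betaPDF,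
        betaPDFReal, if_neg fun h' => h ⟨h'.1.le, h'.2.le⟩, ENNReal.ofReal_zero, mul_zero, mul_zero]
  · rw [indicator_of_notMem hpA,
      indicator_of_notMem (show p ∉ (fun p : ℝ => 1 - 2 * p) ⁻¹' A from hpA), mul_zero, mul_zero]

theorem measurable_parabolicWeight (a b : ℝ) : Measurable (parabolicWeight a b) := by
  unfold parabolicWeight
  fun_prop

theorem measurableSet_parabolicDomain : MeasurableSet parabolicDomain := by
  change MeasurableSet ({x : ℝ × ℝ | x.1 ^ 2 ≤ x.2} ∩ {x | x.2 ≤ 1})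
  exact (measurableSet_le (by fun_prop) (by fun_prop)).inter
    (measurableSet_le (by fun_prop) (by fun_prop))

theorem parabolicWeight_nonneg {a b : ℝ} {x : ℝ × ℝ} (hx : x ∈ parabolicDomain) :
    0 ≤ parabolicWeight a b x :=
  mul_nonneg (Real.rpow_nonneg (sub_nonneg.2 hx.2) _) (Real.rpow_nonneg (sub_nonneg.2 hx.1) _)

/-- The total mass of the weight on the parabolic domain. -/
def parabolicMass (a b : ℝ) : ℝ :=
  2 ^ (2 * b) * beta (b + 1 / 2) (b + 1 / 2) * beta (b + 1) (a + 1)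

theorem parabolicMass_pos {a b : ℝ} (ha : -1 < a) (hb : -1 / 2 < b) : 0 < parabolicMass a b :=
  mul_pos (mul_pos (by positivity) (beta_pos (by linarith) (by linarith)))
    (beta_pos (by linarith) (by linarith))

/-- With `x = (√s (1-2p), s)` one has `x₂ - x₁² = 4 s p (1-p)`, and the substitution in `x₁` has
factor `2√s`. Thus the powers of `s` combine to `s^b`, those of `2` to `2^(2b)`, and `p`, `s` become
independent. -/
theorem withDensity_restrict_parabolicDomain {a b : ℝ} (ha : -1 < a) (hb : -1 / 2 < b) :
    (volume.restrict parabolicDomain).withDensity (fun x => ENNReal.ofReal (parabolicWeight a b x)) =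
      ENNReal.ofReal (parabolicMass a b) •
        ((betaMeasure (b + 1 / 2) (b + 1 / 2)).prod (betaMeasure (b + 1) (a + 1))).map
          fun q => (√q.2 * (1 - 2 * q.1), q.2) := by
  have hφ : Measurable fun q : ℝ × ℝ => (√q.2 * (1 - 2 * q.1), q.2) := by fun_prop
  have hw := (measurable_parabolicWeight a b).ennreal_ofReal
  have hB1 := beta_pos (α := b + 1 / 2) (β := b + 1 / 2) (by linarith) (by linarith)
  have hB2 := beta_pos (α := b + 1) (β := a + 1) (by linarith) (by linarith)
  have hm1 : Measurable (betaPDF (b + 1 / 2) (b + 1 / 2)) := measurable_betaPDF _ _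
  have hm2 : Measurable (betaPDF (b + 1) (a + 1)) := measurable_betaPDF _ _
  ext A hA
  rw [← withDensity_indicator measurableSet_parabolicDomain, withDensity_apply _ hA,
    ← lintegral_indicator hA, Measure.volume_eq_prod,
    lintegral_prod_symm' _ ((hw.indicator measurableSet_parabolicDomain).indicator hA),
    Measure.smul_apply, Measure.map_apply hφ hA, betaMeasure, betaMeasure,
    prod_withDensity hm1 hm2, withDensity_apply _ (hA.preimage hφ),
    ← lintegral_indicator (hA.preimage hφ), lintegral_prod_symm' _ (by
      refine Measurable.indicator ?_ (hA.preimage hφ)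
      fun_prop), smul_eq_mul, ← lintegral_const_mul' _ _ ENNReal.ofReal_ne_top]
  refine lintegral_congr_ae ?_
  filter_upwards [ae_ne_zero_and_ne_one] with s hs
  by_cases hs' : s ∈ Icc (0 : ℝ) 1
  · have hs0 := hs'.1.lt_of_ne hs.1.symm
    have hs1 := hs'.2.lt_of_ne hs.2
    have hr : 0 < √s := Real.sqrt_pos.2 hs0
    have hr2 : √s ^ 2 = s := Real.sq_sqrt hs0.le
    rw [lintegral_comp_sub_mul (c := 2 * √s) (by
        have := (hw.indicator measurableSet_parabolicDomain).indicator hA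
        fun_prop) (by positivity) (√s),
      ← lintegral_const_mul' _ _ ENNReal.ofReal_ne_top,
      ← lintegral_const_mul' _ _ ENNReal.ofReal_ne_top]
    refine lintegral_congr_ae ?_
    filter_upwards [ae_ne_zero_and_ne_one] with p hp
    rw [show √s - 2 * √s * p = √s * (1 - 2 * p) by ring]
    by_cases hpA : (√s * (1 - 2 * p), s) ∈ A
    · rw [indicator_of_mem hpA, indicator_of_mem
        (show (p, s) ∈ (fun q : ℝ × ℝ => (√q.2 * (1 - 2 * q.1), q.2)) ⁻¹' A from hpA)]
      by_cases h : p ∈ Icc (0 : ℝ) 1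
      · have h0 := h.1.lt_of_ne hp.1.symm
        have h1 := h.2.lt_of_ne hp.2
        have hmem : (√s * (1 - 2 * p), s) ∈ parabolicDomain := by
          refine ⟨?_, hs1.le⟩
          simp only [mul_pow, hr2]
          nlinarith [mul_pos hs0 (mul_pos h0 (sub_pos.2 h1))]
        have e1 := mul_betaPDFReal (a := b - 1 / 2) (b := b - 1 / 2) (by linarith) (by linarith)
          h0 h1
        have e2 := mul_betaPDFReal (a := b) (b := a) (by linarith) ha hs0 hs1
        rw [show b - 1 / 2 + 1 = b + 1 / 2 by ring] at e1
        rw [indicator_of_mem hmem, betaPDF, betaPDF, ← ENNReal.ofReal_mul (by positivity),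
          ← ENNReal.ofReal_mul (betaPDFReal_nonneg (by linarith) (by linarith) _),
          ← ENNReal.ofReal_mul (parabolicMass_pos ha hb).le, parabolicMass,
          show ∀ x y z u v : ℝ, x * y * z * (u * v) = x * (y * u) * (z * v) by intros; ring, e1, e2,
          parabolicWeight, show s - (√s * (1 - 2 * p)) ^ 2 = s * (2 * 2 * (p * (1 - p))) by
            rw [mul_pow, hr2]; ring, Real.mul_rpow hs0.le (by
              have := sub_pos.2 h1
              positivity), Real.mul_rpow (by norm_num) (mul_nonneg h0.le (by linarith)),
          Real.mul_rpow two_pos.le two_pos.le, Real.mul_rpow h0.le (by linarith),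
          ← Real.rpow_add two_pos]
        congr 1
        have e3 : s ^ b = s ^ (b - 1 / 2) * √s := by
          rw [Real.sqrt_eq_rpow, ← Real.rpow_add hs0]
          ring_nf
        have e4 : (2 : ℝ) ^ (2 * b) = 2 ^ (b - 1 / 2 + (b - 1 / 2)) * 2 := by
          rw [← Real.rpow_add_one two_ne_zero]
          ring_nf
        rw [e3, e4]
        ring
      · rw [indicator_of_notMem, betaPDF, betaPDFReal, if_neg fun h' => h ⟨h'.1.le, h'.2.le⟩,
          ENNReal.ofReal_zero, mul_zero, zero_mul, mul_zero]
        rintro ⟨h', _⟩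
        simp only [mul_pow, hr2] at h'
        have h2 : (1 - 2 * p) ^ 2 ≤ 1 := le_of_mul_le_mul_left (by linarith) hs0
        have h3 := abs_le.1 ((sq_le_one_iff_abs_le_one _).1 h2)
        exact h ⟨by linarith, by linarith⟩
    · rw [indicator_of_notMem hpA, indicator_of_notMem
        (show (p, s) ∉ (fun q : ℝ × ℝ => (√q.2 * (1 - 2 * q.1), q.2)) ⁻¹' A from hpA), mul_zero,
        mul_zero]
  · have h1 : ∀ v : ℝ, (v, s) ∉ parabolicDomain := fun v hv =>
      hs' ⟨(sq_nonneg v).trans hv.1, hv.2⟩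
    have h2 : betaPDF (b + 1) (a + 1) s = 0 := by
      rw [betaPDF, betaPDFReal, if_neg fun h' => hs' ⟨h'.1.le, h'.2.le⟩, ENNReal.ofReal_zero]
    rw [lintegral_congr (g := fun _ => 0) fun v => indicator_apply_eq_zero.2 fun _ =>
      indicator_of_notMem (h1 v) _, lintegral_congr (g := fun _ => 0) fun p =>
      indicator_apply_eq_zero.2 fun _ => by rw [h2, mul_zero], lintegral_zero, mul_zero]

theorem integral_withDensity_ofReal {X : Type*} [MeasurableSpace X] {μ : Measure X} {w : X → ℝ}
    (hw : Measurable w) (h0 : ∀ᵐ x ∂μ, 0 ≤ w x) (f : X → ℝ) :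
    ∫ x, f x ∂μ.withDensity (fun x => ENNReal.ofReal (w x)) = ∫ x, f x * w x ∂μ := by
  rw [integral_withDensity_eq_integral_toReal_smul hw.ennreal_ofReal (by simp)]
  refine integral_congr_ae ?_
  filter_upwards [h0] with x hx
  rw [ENNReal.toReal_ofReal hx, smul_eq_mul, mul_comm]

theorem integrable_withDensity_ofReal {X : Type*} [MeasurableSpace X] {μ : Measure X} {w : X → ℝ}
    (hw : Measurable w) (h0 : ∀ᵐ x ∂μ, 0 ≤ w x) {f : X → ℝ} :
    Integrable f (μ.withDensity fun x => ENNReal.ofReal (w x)) ↔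
      Integrable (fun x => f x * w x) μ := by
  rw [integrable_withDensity_iff_integrable_smul' hw.ennreal_ofReal (by simp)]
  refine integrable_congr ?_
  filter_upwards [h0] with x hx
  rw [ENNReal.toReal_ofReal hx, smul_eq_mul, mul_comm]

/-- The average over the parabolic domain in the coordinates `x = (√s u, s)`. -/
def parabolicMean (a b : ℝ) (F : ℝ × ℝ → ℝ) : ℝ :=
  ∫ q, F (√q.2 * (1 - 2 * q.1), q.2)
    ∂(betaMeasure (b + 1 / 2) (b + 1 / 2)).prod (betaMeasure (b + 1) (a + 1))

theorem integral_parabolicDomain {a b : ℝ} (ha : -1 < a) (hb : -1 / 2 < b) {F : ℝ × ℝ → ℝ}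
    (hF : Continuous F) :
    ∫ x in parabolicDomain, F x * parabolicWeight a b x =
      parabolicMass a b * parabolicMean a b F := by
  rw [← integral_withDensity_ofReal (measurable_parabolicWeight a b)
    (ae_restrict_of_forall_mem measurableSet_parabolicDomain fun _ => parabolicWeight_nonneg),
    withDensity_restrict_parabolicDomain ha hb, integral_smul_measure,
    ENNReal.toReal_ofReal (parabolicMass_pos ha hb).le, smul_eq_mul, parabolicMean,
    integral_map (by fun_prop) hF.aestronglyMeasurable]

theorem integrable_parabolic {a b : ℝ} (ha : -1 < a) (hb : -1 / 2 < b) {f : ℝ × ℝ → ℝ}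
    (hf : Continuous f) :
    Integrable f ((betaMeasure (b + 1 / 2) (b + 1 / 2)).prod (betaMeasure (b + 1) (a + 1))) := by
  have := isProbabilityMeasureBeta (α := b + 1 / 2) (β := b + 1 / 2) (by linarith) (by linarith)
  have := isProbabilityMeasureBeta (α := b + 1) (β := a + 1) (by linarith) (by linarith)
  exact integrable_of_continuous_of_compl_null (isCompact_Icc.prod isCompact_Icc)
    (measure_prod_compl_null (betaMeasure_compl_Icc _ _) (betaMeasure_compl_Icc _ _)) hf

theorem parabolicInner_eq {a b : ℝ} (ha : -1 < a) (hb : -1 / 2 < b) {f g : ℝ × ℝ → ℝ}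
    (hf : Continuous f) (hg : Continuous g) :
    parabolicInner a b f g = parabolicMean a b fun x => f x * g x := by
  have := isProbabilityMeasureBeta (α := b + 1 / 2) (β := b + 1 / 2) (by linarith) (by linarith)
  have := isProbabilityMeasureBeta (α := b + 1) (β := a + 1) (by linarith) (by linarith)
  have h1 := integral_parabolicDomain ha hb (F := fun _ => 1) continuous_const
  simp only [one_mul, parabolicMean, integral_const, probReal_univ, smul_eq_mul, mul_one] at h1
  rw [parabolicInner, h1, integral_parabolicDomain ha hb (F := fun x => f x * g x) (hf.mul hg),
    inv_mul_cancel_left₀ (parabolicMass_pos ha hb).ne']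

/-! ### Integrals over the square -/

theorem jacobiConst_eq {a b : ℝ} (ha : -1 < a) (hb : -1 < b) :
    jacobiConst a b = (2 ^ (a + b + 1) * beta (a + 1) (b + 1))⁻¹ := by
  have h1 := (Real.Gamma_pos_of_pos (s := a + 1) (by linarith)).ne'
  have h2 := (Real.Gamma_pos_of_pos (s := b + 1) (by linarith)).ne'
  rw [jacobiConst, beta, show -a - b - 1 = -(a + b + 1) by ring, Real.rpow_neg two_pos.le,
    show a + 1 + (b + 1) = a + b + 2 by ring, mul_inv, inv_div]

/-- Legendre's duplication formula at `l + 1/2`. -/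
theorem gegenbauerConst_eq {l : ℝ} (hl : -1 / 2 < l) :
    gegenbauerConst l = jacobiConst (l - 1 / 2) (l - 1 / 2) := by
  have h := Real.Gamma_mul_Gamma_add_half (l + 1 / 2)
  have h1 := (Real.Gamma_pos_of_pos (s := l + 1 / 2) (by linarith)).ne'
  have h2 : √Real.pi ≠ 0 := (Real.sqrt_pos.2 Real.pi_pos).ne'
  rw [show l + 1 / 2 + 1 / 2 = l + 1 by ring, show 2 * (l + 1 / 2) = 2 * l + 1 by ring,
    show 1 - (2 * l + 1) = -(2 * l) by ring] at h
  rw [gegenbauerConst, jacobiConst, Real.Gamma_one_half_eq,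
    show -(l - 1 / 2) - (l - 1 / 2) - 1 = -(2 * l) by ring,
    show l - 1 / 2 + (l - 1 / 2) + 2 = 2 * l + 1 by ring,
    show l - 1 / 2 + 1 = l + 1 / 2 by ring]
  generalize Real.Gamma (l + 1 / 2) = x at *
  generalize 2 * l = m at *
  field_simp
  linear_combination h

/-- The weight of the integral over the square. -/
def squareWeight (a b c : ℝ) (z : ℝ × ℝ) : ℝ :=
  (1 - z.1) ^ a * (1 + z.1) ^ b * (1 - z.2 ^ 2) ^ c

theorem squareWeight_nonneg (a b c : ℝ) {z : ℝ × ℝ}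
    (hz : z ∈ Icc (-1 : ℝ) 1 ×ˢ Icc (-1 : ℝ) 1) : 0 ≤ squareWeight a b c z := by
  obtain ⟨⟨h1, h2⟩, h3, h4⟩ := hz
  refine mul_nonneg (mul_nonneg (Real.rpow_nonneg (by linarith) _)
    (Real.rpow_nonneg (by linarith) _)) (Real.rpow_nonneg ?_ _)
  nlinarith

theorem measurable_squareWeight (a b c : ℝ) : Measurable (squareWeight a b c) := by
  unfold squareWeight
  fun_prop

theorem withDensity_restrict_square {a b c : ℝ} (ha : -1 < a) (hb : -1 < b) (hc : -1 < c) :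
    (volume.restrict (Icc (-1 : ℝ) 1 ×ˢ Icc (-1 : ℝ) 1)).withDensity
        (fun z => ENNReal.ofReal (squareWeight a b c z)) =
      ENNReal.ofReal ((jacobiConst a b * gegenbauerConst (c + 1 / 2))⁻¹) •
        ((betaMeasure (a + 1) (b + 1)).prod (betaMeasure (c + 1) (c + 1))).map
          fun q => (1 - 2 * q.1, 1 - 2 * q.2) := by
  have hB1 := beta_pos (α := a + 1) (β := b + 1) (by linarith) (by linarith)
  have hB2 := beta_pos (α := c + 1) (β := c + 1) (by linarith) (by linarith)
  have := isProbabilityMeasureBeta (α := a + 1) (β := b + 1) (by linarith) (by linarith)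
  have := isProbabilityMeasureBeta (α := c + 1) (β := c + 1) (by linarith) (by linarith)
  have h : (volume.restrict (Icc (-1 : ℝ) 1 ×ˢ Icc (-1 : ℝ) 1)).withDensity
        (fun z => ENNReal.ofReal (squareWeight a b c z)) =
      ((volume.restrict (Icc (-1) 1)).withDensity
        (fun z : ℝ => ENNReal.ofReal ((1 - z) ^ a * (1 + z) ^ b))).prod
      ((volume.restrict (Icc (-1) 1)).withDensity
        (fun z : ℝ => ENNReal.ofReal ((1 - z) ^ c * (1 + z) ^ c))) := by
    rw [prod_withDensity (by fun_prop) (by fun_prop), Measure.prod_restrict,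
      ← Measure.volume_eq_prod]
    refine withDensity_congr_ae (ae_restrict_of_forall_mem
      (measurableSet_Icc.prod measurableSet_Icc) fun z hz => ?_)
    obtain ⟨⟨h1, h2⟩, h3, h4⟩ := hz
    simp only
    rw [← ENNReal.ofReal_mul (mul_nonneg (Real.rpow_nonneg (by linarith) _)
      (Real.rpow_nonneg (by linarith) _)), squareWeight,
      ← Real.mul_rpow (x := 1 - z.2) (by linarith) (by linarith)]
    ring_nf
  rw [h, withDensity_restrict_Icc_neg_one_one ha hb, withDensity_restrict_Icc_neg_one_one hc hc,
    gegenbauerConst_eq (by linarith), add_sub_cancel_right, jacobiConst_eq ha hb,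
    jacobiConst_eq hc hc, mul_inv, inv_inv, inv_inv,
    ENNReal.ofReal_mul (p := 2 ^ (a + b + 1) * beta (a + 1) (b + 1)) (by positivity), mul_smul,
    Measure.prod_smul_left, Measure.prod_smul_right,
    Measure.map_prod_map _ _ (by fun_prop) (by fun_prop)]
  rfl

theorem integrableOn_square {a b c : ℝ} (ha : -1 < a) (hb : -1 < b) (hc : -1 < c)
    {F : ℝ × ℝ → ℝ} (hF : Continuous F) :
    IntegrableOn (fun z => F z * squareWeight a b c z) (Icc (-1 : ℝ) 1 ×ˢ Icc (-1 : ℝ) 1) := by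
  have := isProbabilityMeasureBeta (α := a + 1) (β := b + 1) (by linarith) (by linarith)
  have := isProbabilityMeasureBeta (α := c + 1) (β := c + 1) (by linarith) (by linarith)
  rw [IntegrableOn, ← integrable_withDensity_ofReal (measurable_squareWeight a b c)
    (ae_restrict_of_forall_mem (measurableSet_Icc.prod measurableSet_Icc)
      fun _ => squareWeight_nonneg a b c), withDensity_restrict_square ha hb hc]
  refine Integrable.smul_measure ?_ ENNReal.ofReal_ne_top
  rw [integrable_map_measure hF.aestronglyMeasurable (by fun_prop)]
  exact integrable_of_continuous_of_compl_null (isCompact_Icc.prod isCompact_Icc)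
    (measure_prod_compl_null (betaMeasure_compl_Icc _ _) (betaMeasure_compl_Icc _ _))
    (hF.comp (by fun_prop))

theorem integral_square {a b c : ℝ} (ha : -1 < a) (hb : -1 < b) (hc : -1 < c)
    {F : ℝ × ℝ → ℝ} (hF : Continuous F) :
    jacobiConst a b * gegenbauerConst (c + 1 / 2) *
      ∫ z in Icc (-1 : ℝ) 1 ×ˢ Icc (-1 : ℝ) 1, F z * squareWeight a b c z =
    ∫ q, F (1 - 2 * q.1, 1 - 2 * q.2)
      ∂(betaMeasure (a + 1) (b + 1)).prod (betaMeasure (c + 1) (c + 1)) := by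
  have hpos : 0 < jacobiConst a b * gegenbauerConst (c + 1 / 2) := by
    have hB1 := beta_pos (α := a + 1) (β := b + 1) (by linarith) (by linarith)
    have hB2 := beta_pos (α := c + 1) (β := c + 1) (by linarith) (by linarith)
    rw [gegenbauerConst_eq (by linarith), add_sub_cancel_right, jacobiConst_eq ha hb,
      jacobiConst_eq hc hc]
    positivity
  rw [← integral_withDensity_ofReal (measurable_squareWeight a b c)
    (ae_restrict_of_forall_mem (measurableSet_Icc.prod measurableSet_Icc)
      fun _ => squareWeight_nonneg a b c), withDensity_restrict_square ha hb hc,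
    integral_smul_measure, ENNReal.toReal_ofReal (inv_pos.2 hpos).le, smul_eq_mul,
    mul_inv_cancel_left₀ hpos.ne', integral_map (by fun_prop) hF.aestronglyMeasurable]

/-! ### Integrals over the surface -/

theorem continuous_surfacePoint (d : ℕ) :
    Continuous fun p : Metric.sphere (0 : EuclideanSpace ℝ (Fin d)) 1 × Icc (0 : ℝ) 1 =>
      surfacePoint p.1 p.2 := by
  unfold surfacePoint
  fun_prop

/-- The average over the surface in the coordinates `(√s η, s)`. -/
def surfaceMean (d : ℕ) (b γ : ℝ)
    (F : Metric.sphere (0 : EuclideanSpace ℝ (Fin d)) 1 × ℝ → ℝ) : ℝ :=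
  ∫ q, F q ∂(sphereProb d).prod (betaMeasure (b + 1) (γ + 1))

/-- The factor `t^((d-1)/2)` of the measure merges with `t^β` into `t^b`. The law of `t` is then the
same as that of `s` in `parabolicMean γ b`, which explains the parameter `β + (d-1)/2` of the planar
kernel. -/
theorem integral_surfaceMeasure {d : ℕ} [NeZero d] (hd : 2 ≤ d) {β γ : ℝ} (hβ : -1 / 2 ≤ β)
    (hγ : -1 < γ) :
    ∃ c > 0, ∀ (F : surface d → ℝ) (G : Metric.sphere (0 : EuclideanSpace ℝ (Fin d)) 1 × ℝ → ℝ),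
      Continuous F → (∀ ξ t, F (surfacePoint ξ t) = G (ξ, t)) →
      ∫ p, F p * surfaceWeight β γ p.1.2 ∂surfaceMeasure d =
        c * surfaceMean d (β + ((d : ℝ) - 1) / 2) γ G := by
  have hd' : (2 : ℝ) ≤ d := by exact_mod_cast hd
  set b := β + ((d : ℝ) - 1) / 2 with hb
  have hb1 : -1 < b := by linarith
  have hB := beta_pos (α := b + 1) (β := γ + 1) (by linarith) (by linarith)
  set τ := (volume : Measure (EuclideanSpace ℝ (Fin d))).toSphere with hτ
  have hτ0 : τ univ ≠ 0 := by
    rw [Ne, Measure.measure_univ_eq_zero]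
    exact Measure.toSphere_ne_zero _
  have := isProbabilityMeasureBeta (α := b + 1) (β := γ + 1) (by linarith) (by linarith)
  refine ⟨(τ univ).toReal * beta (b + 1) (γ + 1),
    mul_pos (ENNReal.toReal_pos hτ0 (measure_ne_top _ _)) hB, fun F G hF hG => ?_⟩
  have hs : Measurable fun t : ℝ => t ^ (((d : ℝ) - 1) / 2) := by fun_prop
  have hemb : MeasurableEmbedding (Prod.map id Subtype.val :
      Metric.sphere (0 : EuclideanSpace ℝ (Fin d)) 1 × Icc (0 : ℝ) 1 →
      Metric.sphere (0 : EuclideanSpace ℝ (Fin d)) 1 × ℝ) :=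
    MeasurableEmbedding.id.prodMap (MeasurableEmbedding.subtype_coe measurableSet_Icc)
  have hmp : MeasurePreserving (Prod.map id Subtype.val :
      Metric.sphere (0 : EuclideanSpace ℝ (Fin d)) 1 × Icc (0 : ℝ) 1 →
      Metric.sphere (0 : EuclideanSpace ℝ (Fin d)) 1 × ℝ)
      (τ.prod volume) (τ.prod (volume.restrict (Icc 0 1))) :=
    (MeasurePreserving.id τ).prod (measurePreserving_subtype_coe measurableSet_Icc)
  calc
    ∫ p, F p * surfaceWeight β γ p.1.2 ∂surfaceMeasure d
        = ∫ p, G (p.1, p.2) * surfaceWeight β γ p.2 ∂τ.prod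
          ((volume : Measure (Icc (0 : ℝ) 1)).withDensity
            fun t => ENNReal.ofReal ((t : ℝ) ^ (((d : ℝ) - 1) / 2))) := by
      rw [surfaceMeasure, integral_map (continuous_surfacePoint d).aemeasurable]
      · simp only [hG]
        rfl
      · refine (hF.measurable.mul ?_).aestronglyMeasurable
        unfold surfaceWeight
        fun_prop
    _ = ∫ p, G (p.1, p.2) * surfaceWeight β γ p.2 * (p.2 : ℝ) ^ (((d : ℝ) - 1) / 2)
          ∂τ.prod (volume : Measure (Icc (0 : ℝ) 1)) := by
      rw [prod_withDensity_right (by fun_prop), integral_withDensity_ofReal (by fun_prop)]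
      exact .of_forall fun p => Real.rpow_nonneg p.2.2.1 _
    _ = ∫ p, G p * surfaceWeight β γ p.2 * p.2 ^ (((d : ℝ) - 1) / 2)
          ∂τ.prod (volume.restrict (Icc 0 1)) := by
      rw [← hmp.integral_comp hemb]
      rfl
    _ = ∫ p, G p * (p.2 ^ b * (1 - p.2) ^ γ) ∂τ.prod (volume.restrict (Icc 0 1)) := by
      refine integral_congr_ae ?_
      -- Adding exponents of `t` needs `t ≠ 0`.
      have h1 : ∀ᵐ p ∂τ.prod (volume.restrict (Icc (0 : ℝ) 1)), p.2 ∈ Ioc (0 : ℝ) 1 := by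
        refine Measure.quasiMeasurePreserving_snd.ae (p := fun s => s ∈ Ioc (0 : ℝ) 1) ?_
        filter_upwards [ae_restrict_mem measurableSet_Icc,
          ae_restrict_of_ae ae_ne_zero_and_ne_one] with s h1 h2
        exact ⟨h1.1.lt_of_ne h2.1.symm, h1.2⟩
      filter_upwards [h1] with p hp
      rw [surfaceWeight, hb, Real.rpow_add hp.1]
      ring
    _ = ∫ p, G p ∂τ.prod ((volume.restrict (Icc (0 : ℝ) 1)).withDensity
          fun s => ENNReal.ofReal (s ^ b * (1 - s) ^ γ)) := by
      rw [prod_withDensity_right (by fun_prop), integral_withDensity_ofReal (by fun_prop)]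
      refine Measure.quasiMeasurePreserving_snd.ae
        (p := fun s : ℝ => 0 ≤ s ^ b * (1 - s) ^ γ) ?_
      filter_upwards [ae_restrict_mem measurableSet_Icc] with s hs
      exact mul_nonneg (Real.rpow_nonneg hs.1 _) (Real.rpow_nonneg (by linarith [hs.2]) _)
    _ = _ := by
      rw [withDensity_restrict_Icc_zero_one hb1 hγ, Measure.prod_smul_right, surfaceMean,
        sphereProb, Measure.prod_smul_left, integral_smul_measure, integral_smul_measure,
        ENNReal.toReal_ofReal hB.le, ENNReal.toReal_inv, smul_eq_mul, smul_eq_mul]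
      have : (τ univ).toReal ≠ 0 := ENNReal.toReal_ne_zero.2 ⟨hτ0, measure_ne_top _ _⟩
      rw [← hτ]
      field_simp

/-- A polynomial on the surface in the coordinates `(√s η, s)`. -/
def surfaceEval {d : ℕ} (P : MvPolynomial (Fin d ⊕ Unit) ℝ)
    (q : Metric.sphere (0 : EuclideanSpace ℝ (Fin d)) 1 × ℝ) : ℝ :=
  MvPolynomial.eval (Sum.elim (fun i => √q.2 * q.1.1 i) fun _ => q.2) P

theorem continuous_surfaceEval {d : ℕ} (P : MvPolynomial (Fin d ⊕ Unit) ℝ) :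
    Continuous (surfaceEval P) := by
  refine (MvPolynomial.continuous_eval P).comp (continuous_pi fun i => ?_)
  cases i
  · simp only [Sum.elim_inl]
    fun_prop
  · simp only [Sum.elim_inr]
    fun_prop

theorem continuous_surfacePoly {d : ℕ} (P : MvPolynomial (Fin d ⊕ Unit) ℝ) :
    Continuous (surfacePoly P) := by
  refine (MvPolynomial.continuous_eval P).comp (continuous_pi fun i => ?_)
  cases i
  · simp only [Sum.elim_inl]
    fun_prop
  · simp only [Sum.elim_inr]
    fun_prop

theorem integrable_surface {d : ℕ} [NeZero d] {b γ : ℝ} (hb : -1 < b) (hγ : -1 < γ)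
    {f : Metric.sphere (0 : EuclideanSpace ℝ (Fin d)) 1 × ℝ → ℝ} (hf : Continuous f) :
    Integrable f ((sphereProb d).prod (betaMeasure (b + 1) (γ + 1))) := by
  have := isProbabilityMeasureBeta (α := b + 1) (β := γ + 1) (by linarith) (by linarith)
  refine integrable_of_continuous_of_compl_null
    (isCompact_univ.prod (isCompact_Icc (a := 0) (b := 1))) ?_ hf
  rw [compl_prod_eq_union]
  simp [betaMeasure_compl_Icc]

theorem surfaceInner_eq {d : ℕ} [NeZero d] (hd : 2 ≤ d) {β γ : ℝ} (hβ : -1 / 2 ≤ β)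
    (hγ : -1 < γ) (P Q : MvPolynomial (Fin d ⊕ Unit) ℝ) :
    surfaceInner d β γ (surfacePoly P) (surfacePoly Q) =
      surfaceMean d (β + ((d : ℝ) - 1) / 2) γ fun q => surfaceEval P q * surfaceEval Q q := by
  have hd' : (2 : ℝ) ≤ d := by exact_mod_cast hd
  have := isProbabilityMeasureBeta (α := β + ((d : ℝ) - 1) / 2 + 1) (β := γ + 1) (by linarith)
    (by linarith)
  obtain ⟨c, hc, h⟩ := integral_surfaceMeasure hd hβ hγ
  have h1 := h (fun _ => 1) (fun _ => 1) continuous_const fun _ _ => rfl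
  simp only [one_mul, surfaceMean, integral_const, probReal_univ, smul_eq_mul, mul_one] at h1
  rw [surfaceInner, h1, h (fun p => surfacePoly P p * surfacePoly Q p)
    (fun q => surfaceEval P q * surfaceEval Q q)
    ((continuous_surfacePoly P).mul (continuous_surfacePoly Q)) fun ξ t => rfl,
    inv_mul_cancel_left₀ hc.ne', surfaceMean]

/-! ### Plane polynomials on the curves `x₂ = r²` -/

theorem continuous_planePoly (p : MvPolynomial (Fin 2) ℝ) : Continuous (planePoly p) := by
  refine (MvPolynomial.continuous_eval p).comp (continuous_pi fun i => ?_)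
  fin_cases i
  · exact continuous_fst
  · exact continuous_snd

/-- The polynomial `u ↦ p (r u, r²)`. -/
def fibre (r : ℝ) : MvPolynomial (Fin 2) ℝ →ₐ[ℝ] ℝ[X] :=
  MvPolynomial.aeval ![C r * X, C (r ^ 2)]

theorem eval_fibre (r u : ℝ) (p : MvPolynomial (Fin 2) ℝ) :
    (fibre r p).eval u = planePoly p (r * u, r ^ 2) := by
  rw [← coe_aeval_eq_eval, fibre, MvPolynomial.comp_aeval_apply, planePoly,
    ← MvPolynomial.coe_aeval_eq_eval]
  change MvPolynomial.aeval _ p = MvPolynomial.aeval _ p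
  congr 2
  ext i
  fin_cases i <;> simp

theorem fibre_eq_sum (r : ℝ) (p : MvPolynomial (Fin 2) ℝ) :
    fibre r p = ∑ κ ∈ p.support, C (p.coeff κ * r ^ (κ 0 + 2 * κ 1)) * X ^ κ 0 := by
  rw [fibre, MvPolynomial.aeval_def, MvPolynomial.eval₂_eq']
  refine Finset.sum_congr rfl fun κ _ => ?_
  simp [Fin.prod_univ_two]
  ring

/-- If `m + 2k = i` then `r^i u^m = (r u)^m (r²)^k`, which comes from a monomial of degree `m + k ≤
i`. -/
theorem exists_fibre_eq {i : ℕ} {f : ℝ[X]} (hf : f ∈ paritySpace i) :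
    ∃ q : MvPolynomial (Fin 2) ℝ, q.totalDegree ≤ i ∧ ∀ r, fibre r q = C (r ^ i) * f := by
  let W : Submodule ℝ ℝ[X] :=
    { carrier := {f | ∃ q : MvPolynomial (Fin 2) ℝ, q.totalDegree ≤ i ∧
        ∀ r, fibre r q = C (r ^ i) * f}
      add_mem' := by
        rintro f g ⟨p, hp, hp'⟩ ⟨q, hq, hq'⟩
        exact ⟨p + q, (MvPolynomial.totalDegree_add p q).trans (max_le hp hq), fun r => by
          rw [map_add, hp', hq', mul_add]⟩
      zero_mem' := ⟨0, by simp, by simp⟩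
      smul_mem' := by
        rintro c f ⟨q, hq, hq'⟩
        exact ⟨c • q, (MvPolynomial.totalDegree_smul_le c q).trans hq, fun r => by
          rw [map_smul, hq', mul_smul_comm]⟩ }
  refine (paritySpace_le_iff (W := W)).2 (fun m k h => ?_) hf
  refine ⟨MvPolynomial.X 0 ^ m * MvPolynomial.X 1 ^ k, ?_, fun r => ?_⟩
  · refine (MvPolynomial.totalDegree_mul _ _).trans ?_
    rw [MvPolynomial.totalDegree_X_pow, MvPolynomial.totalDegree_X_pow]
    omega
  · simp [fibre, ← h]
    ring

theorem degree_le_of_mem_support {σ : Type*} [Fintype σ] {p : MvPolynomial σ ℝ} {n : ℕ}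
    (hp : p.totalDegree ≤ n) {κ : σ →₀ ℕ} (hκ : κ ∈ p.support) : ∑ i, κ i ≤ n := by
  refine le_trans ?_ ((MvPolynomial.le_totalDegree hκ).trans hp)
  rw [Finsupp.sum_fintype _ _ fun _ => rfl]

/-- A monomial `x₁^m x₂^k` restricts to `r^(m+2k) u^m`, and `r^m τ(u^m)` comes from a polynomial of
degree at most `m`. So `τ` acts curve by curve on plane polynomials without raising the degree. -/
theorem exists_fibre_eq_map {τ : ℝ[X] →ₗ[ℝ] ℝ[X]} (hτ : ∀ k, τ (X ^ k) ∈ paritySpace k) {n : ℕ}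
    {p : MvPolynomial (Fin 2) ℝ} (hp : p.totalDegree ≤ n) :
    ∃ q : MvPolynomial (Fin 2) ℝ, q.totalDegree ≤ n ∧ ∀ r, fibre r q = τ (fibre r p) := by
  choose q hq hq' using fun k => exists_fibre_eq (hτ k)
  refine ⟨∑ κ ∈ p.support, p.coeff κ • (q (κ 0) * MvPolynomial.X 1 ^ κ 1),
    MvPolynomial.totalDegree_finsetSum_le fun κ hκ => ?_, fun r => ?_⟩
  · have h1 := degree_le_of_mem_support hp hκ
    rw [Fin.sum_univ_two] at h1
    refine (MvPolynomial.totalDegree_smul_le _ _).trans ((MvPolynomial.totalDegree_mul _ _).trans ?_)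
    rw [MvPolynomial.totalDegree_X_pow]
    have := hq (κ 0)
    omega
  · rw [fibre_eq_sum r p, map_sum, map_sum]
    refine Finset.sum_congr rfl fun κ _ => ?_
    rw [map_smul, map_mul, hq', ← smul_eq_C_mul (p.coeff κ * _), map_smul, smul_eq_C_mul,
      smul_eq_C_mul]
    simp [fibre]
    ring

theorem totalDegree_aeval_le {σ ι : Type*} {f : σ → MvPolynomial ι ℝ}
    (hf : ∀ i, (f i).totalDegree ≤ 1) (p : MvPolynomial σ ℝ) :
    (MvPolynomial.aeval f p).totalDegree ≤ p.totalDegree := by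
  rw [MvPolynomial.aeval_def, MvPolynomial.eval₂_eq]
  refine MvPolynomial.totalDegree_finsetSum_le fun κ hκ => ?_
  refine (MvPolynomial.totalDegree_mul _ _).trans ?_
  rw [MvPolynomial.algebraMap_eq, MvPolynomial.totalDegree_C, zero_add]
  refine (MvPolynomial.totalDegree_finsetProd _ _).trans (le_trans ?_
    (MvPolynomial.le_totalDegree hκ))
  refine Finset.sum_le_sum fun i _ => (MvPolynomial.totalDegree_pow _ _).trans ?_
  exact (Nat.mul_le_mul_left _ (hf i)).trans (mul_one _).le

/-- The polynomial `(y, s) ↦ p (⟨ξ, y⟩, s)`. -/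
def zonalLift {d : ℕ} (ξ : EuclideanSpace ℝ (Fin d)) :
    MvPolynomial (Fin 2) ℝ →ₐ[ℝ] MvPolynomial (Fin d ⊕ Unit) ℝ :=
  MvPolynomial.aeval ![∑ i, MvPolynomial.C (ξ i) * MvPolynomial.X (Sum.inl i),
    MvPolynomial.X (Sum.inr ())]

theorem totalDegree_zonalLift_le {d : ℕ} (ξ : EuclideanSpace ℝ (Fin d))
    (p : MvPolynomial (Fin 2) ℝ) : (zonalLift ξ p).totalDegree ≤ p.totalDegree := by
  refine totalDegree_aeval_le (fun i => ?_) p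
  fin_cases i
  · change (∑ j, MvPolynomial.C (ξ j) * MvPolynomial.X (Sum.inl j)).totalDegree ≤ 1
    refine MvPolynomial.totalDegree_finsetSum_le fun j _ => ?_
    exact (MvPolynomial.isHomogeneous_C_mul_X (ξ j) (Sum.inl j : Fin d ⊕ Unit)).totalDegree_le
  · exact (MvPolynomial.totalDegree_X (R := ℝ) (Sum.inr () : Fin d ⊕ Unit)).le

theorem surfaceEval_zonalLift {d : ℕ} (ξ : EuclideanSpace ℝ (Fin d)) (p : MvPolynomial (Fin 2) ℝ)
    (η : Metric.sphere (0 : EuclideanSpace ℝ (Fin d)) 1) {s : ℝ} (hs : 0 ≤ s) :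
    surfaceEval (zonalLift ξ p) (η, s) = (fibre √s p).eval (inner ℝ ξ η.1) := by
  rw [eval_fibre, Real.sq_sqrt hs, surfaceEval, ← MvPolynomial.coe_aeval_eq_eval, zonalLift]
  change MvPolynomial.aeval _ (MvPolynomial.aeval _ p) = _
  rw [MvPolynomial.comp_aeval_apply, planePoly, ← MvPolynomial.coe_aeval_eq_eval]
  change MvPolynomial.aeval _ p = MvPolynomial.aeval _ p
  congr 2
  ext i
  fin_cases i
  · simp [PiLp.inner_apply, Finset.mul_sum]
    exact Finset.sum_congr rfl fun j _ => by ring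
  · simp

theorem gegenbauerMean_apply {l : ℝ} (hl : -1 / 2 < l) (φ : ℝ[X]) :
    gegenbauerMean l φ = ∫ p, φ.eval (1 - 2 * p) ∂betaMeasure (l + 1 / 2) (l + 1 / 2) := by
  rw [gegenbauerMean, betaMean_apply (by linarith) (by linarith)]
  have : ∀ p : ℝ, p * -1 + (1 - p) * 1 = 1 - 2 * p := fun p => by ring
  simp only [this]

theorem ae_betaMeasure_nonneg (a b : ℝ) : ∀ᵐ s ∂betaMeasure a b, 0 ≤ s := by
  filter_upwards [mem_ae_iff.2 (betaMeasure_compl_Icc a b)] with s hs using hs.1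

theorem eval_monomial_sum {d : ℕ} (κ : Fin d ⊕ Unit →₀ ℕ) (c : ℝ)
    (η : Metric.sphere (0 : EuclideanSpace ℝ (Fin d)) 1) {s : ℝ} (hs : 0 ≤ s) :
    surfaceEval (MvPolynomial.monomial κ c) (η, s) =
      c * (√s ^ (∑ i, κ (Sum.inl i) + 2 * κ (Sum.inr ())) *
        MvPolynomial.eval (η.1 : Fin d → ℝ) (∏ i, MvPolynomial.X i ^ κ (Sum.inl i))) := by
  rw [surfaceEval, MvPolynomial.eval_monomial, Finsupp.prod_fintype _ _ fun _ => pow_zero _,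
    Fintype.prod_sum_type]
  simp only [Sum.elim_inl, Sum.elim_inr, Finset.univ_unique, Finset.sum_singleton, mul_pow,
    Finset.prod_mul_distrib, Finset.prod_pow_eq_pow_sum, map_prod, map_pow, MvPolynomial.eval_X,
    pow_add, pow_mul, Real.sq_sqrt hs, PUnit.default_eq_unit]
  ring

/-! ### Transfer of polynomials from the surface to the parabolic domain. -/

section Transfer

variable {d : ℕ} [NeZero d] {b γ : ℝ} {τ : ℝ[X] →ₗ[ℝ] ℝ[X]}

/-- Transfer of a monomial on the surface to the parabolic domain. -/
theorem exists_transfer_monomial (hd : 2 ≤ d) (hb : -1 / 2 < b) (hγ : -1 < γ)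
    (hτ : ∀ n, τ (zonalPoly b n) = zonalPoly (((d : ℝ) - 2) / 2) n)
    (ξ : Metric.sphere (0 : EuclideanSpace ℝ (Fin d)) 1) (κ : Fin d ⊕ Unit →₀ ℕ) :
    ∃ q : MvPolynomial (Fin 2) ℝ, q.totalDegree ≤ ∑ i, κ i ∧
      (∀ t : ℝ, 0 ≤ t → planePoly q (√t, t) =
        surfaceEval (MvPolynomial.monomial κ 1) (ξ, t)) ∧
      ∀ g G : MvPolynomial (Fin 2) ℝ, (∀ r, fibre r G = τ (fibre r g)) →
        surfaceMean d b γ (fun x => surfaceEval (MvPolynomial.monomial κ 1) x *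
          surfaceEval (zonalLift ξ.1 G) x) =
        parabolicMean γ b fun x => planePoly q x * planePoly g x := by
  have hd' : (2 : ℝ) ≤ d := by exact_mod_cast hd
  have hl : -1 / 2 < ((d : ℝ) - 2) / 2 := by linarith
  set P : MvPolynomial (Fin d) ℝ := ∏ i, MvPolynomial.X i ^ κ (Sum.inl i)
  set i := ∑ i, κ (Sum.inl i)
  set j := κ (Sum.inr ())
  have hP : P.IsHomogeneous i := MvPolynomial.IsHomogeneous.prod _ _ _ fun m _ =>
    MvPolynomial.isHomogeneous_X_pow m _
  -- The angular factor is averaged about `ξ`, then moved from parameter `l` to `b` by the adjoint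
  -- of `τ`; both operations keep the value at the pole, and the parity makes `r^i h` a plane
  -- polynomial.
  obtain ⟨h₀, hh₀, h₀1, h₀2⟩ := exists_zonal_projection hd ξ hP
  obtain ⟨h, hh, h1, h2⟩ := exists_adjoint hb hl hτ hh₀
  obtain ⟨q, hq, hq'⟩ := exists_fibre_eq hh
  have hfib : ∀ r, fibre r (q * MvPolynomial.X 1 ^ j) = C (r ^ (i + 2 * j)) * h := fun r => by
    rw [map_mul, hq', map_pow]
    simp [fibre]
    ring
  refine ⟨q * MvPolynomial.X 1 ^ j, ?_, fun t ht => ?_, fun g G hG => ?_⟩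
  · refine (MvPolynomial.totalDegree_mul _ _).trans ?_
    rw [MvPolynomial.totalDegree_X_pow, Fintype.sum_sum_type, Fintype.sum_unique fun u : Unit => κ (Sum.inr u)]
    exact Nat.add_le_add_right hq _
  · have := eval_fibre √t 1 (q * MvPolynomial.X 1 ^ j)
    rw [mul_one, Real.sq_sqrt ht] at this
    rw [← this, hfib, eval_monomial_sum _ _ _ ht, eval_mul, eval_C, h1, h₀1, one_mul]
  · set ν := betaMeasure (b + 1) (γ + 1)
    have hν := isProbabilityMeasureBeta (α := b + 1) (β := γ + 1) (by linarith) (by linarith)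
    have hμ := isProbabilityMeasureBeta (α := b + 1 / 2) (β := b + 1 / 2) (by linarith)
      (by linarith)
    have hPc := MvPolynomial.continuous_eval P
    -- Over the monomials of `g` both means split into an angular and a radial factor. The radial
    -- integrals coincide, and the angular ones agree by adjointness.
    have e1 : surfaceMean d b γ (fun x => surfaceEval (MvPolynomial.monomial κ 1) x *
        surfaceEval (zonalLift ξ.1 G) x) = ∑ κ' ∈ g.support, g.coeff κ' *
        (gegenbauerMean (((d : ℝ) - 2) / 2) (h₀ * τ (X ^ κ' 0)) *
          ∫ s, √s ^ (i + 2 * j + (κ' 0 + 2 * κ' 1)) ∂ν) := by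
      have h3 : surfaceMean d b γ (fun x => surfaceEval (MvPolynomial.monomial κ 1) x *
          surfaceEval (zonalLift ξ.1 G) x) = ∫ x, ∑ κ' ∈ g.support, g.coeff κ' *
          ((MvPolynomial.eval (x.1.1 : Fin d → ℝ) P * (τ (X ^ κ' 0)).eval (inner ℝ ξ.1 x.1.1)) *
            √x.2 ^ (i + 2 * j + (κ' 0 + 2 * κ' 1))) ∂(sphereProb d).prod ν := by
        refine integral_congr_ae ?_
        filter_upwards [Measure.quasiMeasurePreserving_snd.ae
          (ae_betaMeasure_nonneg (b + 1) (γ + 1))] with x hx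
        rw [eval_monomial_sum _ _ _ hx, surfaceEval_zonalLift _ _ _ hx, hG, fibre_eq_sum, map_sum,
          eval_finsetSum, Finset.mul_sum]
        refine Finset.sum_congr rfl fun κ' _ => ?_
        rw [← smul_eq_C_mul, map_smul, eval_smul, smul_eq_mul]
        ring
      rw [h3, integral_finsetSum _ fun κ' _ => integrable_surface (by linarith) hγ (by fun_prop)]
      refine Finset.sum_congr rfl fun κ' _ => ?_
      rw [integral_const_mul, integral_prod_mul
        (fun η : Metric.sphere (0 : EuclideanSpace ℝ (Fin d)) 1 =>
          MvPolynomial.eval (η.1 : Fin d → ℝ) P * (τ (X ^ κ' 0)).eval (inner ℝ ξ.1 η.1))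
        (fun s : ℝ => √s ^ (i + 2 * j + (κ' 0 + 2 * κ' 1))), h₀2]
    have e2 : parabolicMean γ b (fun x => planePoly (q * MvPolynomial.X 1 ^ j) x * planePoly g x) =
        ∑ κ' ∈ g.support, g.coeff κ' * (gegenbauerMean b (h * X ^ κ' 0) *
          ∫ s, √s ^ (i + 2 * j + (κ' 0 + 2 * κ' 1)) ∂ν) := by
      have h3 : parabolicMean γ b
          (fun x => planePoly (q * MvPolynomial.X 1 ^ j) x * planePoly g x) =
          ∫ x, ∑ κ' ∈ g.support, g.coeff κ' * ((h * X ^ κ' 0).eval (1 - 2 * x.1) *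
            √x.2 ^ (i + 2 * j + (κ' 0 + 2 * κ' 1)))
            ∂(betaMeasure (b + 1 / 2) (b + 1 / 2)).prod ν := by
        refine integral_congr_ae ?_
        filter_upwards [Measure.quasiMeasurePreserving_snd.ae
          (ae_betaMeasure_nonneg (b + 1) (γ + 1))] with x hx
        have h4 := fun p => eval_fibre √x.2 (1 - 2 * x.1) p
        rw [Real.sq_sqrt hx] at h4
        rw [← h4, ← h4, hfib, fibre_eq_sum, eval_finsetSum, Finset.mul_sum]
        refine Finset.sum_congr rfl fun κ' _ => ?_
        simp only [eval_mul, eval_C, eval_pow, eval_X]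
        ring
      rw [h3, integral_finsetSum _ fun κ' _ => integrable_parabolic hγ hb (by fun_prop)]
      refine Finset.sum_congr rfl fun κ' _ => ?_
      rw [integral_const_mul, integral_prod_mul (L := ℝ) (fun p : ℝ => Polynomial.eval (1 - 2 * p) (h * X ^ κ' 0))
        (fun s : ℝ => √s ^ (i + 2 * j + (κ' 0 + 2 * κ' 1))), gegenbauerMean_apply hb]
    rw [e1, e2]
    exact Finset.sum_congr rfl fun κ' _ => by rw [h2]

/-- Transfer of a polynomial on the surface to the parabolic domain. -/
theorem exists_transfer (hd : 2 ≤ d) (hb : -1 / 2 < b) (hγ : -1 < γ)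
    (hτ : ∀ n, τ (zonalPoly b n) = zonalPoly (((d : ℝ) - 2) / 2) n)
    (ξ : Metric.sphere (0 : EuclideanSpace ℝ (Fin d)) 1) (Q : MvPolynomial (Fin d ⊕ Unit) ℝ) :
    ∃ q : MvPolynomial (Fin 2) ℝ, q.totalDegree ≤ Q.totalDegree ∧
      (∀ t : ℝ, 0 ≤ t → planePoly q (√t, t) = surfaceEval Q (ξ, t)) ∧
      ∀ g G : MvPolynomial (Fin 2) ℝ, (∀ r, fibre r G = τ (fibre r g)) →
        surfaceMean d b γ (fun x => surfaceEval Q x * surfaceEval (zonalLift ξ.1 G) x) =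
        parabolicMean γ b fun x => planePoly q x * planePoly g x := by
  choose q hq hq1 hq2 using exists_transfer_monomial hd hb hγ hτ ξ
  have hQ : ∀ x, surfaceEval Q x = ∑ κ ∈ Q.support,
      Q.coeff κ * surfaceEval (MvPolynomial.monomial κ 1) x := fun x => by
    conv_lhs => rw [Q.as_sum]
    rw [surfaceEval, map_sum]
    refine Finset.sum_congr rfl fun κ _ => ?_
    rw [surfaceEval, MvPolynomial.eval_monomial, MvPolynomial.eval_monomial, one_mul]
  have hsum : ∀ x, planePoly (∑ κ ∈ Q.support, Q.coeff κ • q κ) x =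
      ∑ κ ∈ Q.support, Q.coeff κ * planePoly (q κ) x := fun x => by
    rw [planePoly, map_sum]
    exact Finset.sum_congr rfl fun κ _ => MvPolynomial.smul_eval _ _ _
  refine ⟨∑ κ ∈ Q.support, Q.coeff κ • q κ, MvPolynomial.totalDegree_finsetSum_le fun κ hκ =>
    (MvPolynomial.totalDegree_smul_le _ _).trans
      ((hq κ).trans (degree_le_of_mem_support le_rfl hκ)), fun t ht => ?_, fun g G hG => ?_⟩
  · rw [hsum, hQ]
    exact Finset.sum_congr rfl fun κ _ => by rw [hq1 κ t ht]
  · have hcs := fun κ => continuous_surfaceEval (d := d) (MvPolynomial.monomial κ 1)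
    have hcz := continuous_surfaceEval (zonalLift ξ.1 G)
    have hcp := fun κ => continuous_planePoly (q κ)
    have hcg := continuous_planePoly g
    simp only [hQ, hsum, Finset.sum_mul, surfaceMean, parabolicMean, mul_assoc]
    rw [integral_finsetSum _ fun κ _ => integrable_surface (by linarith) hγ
        (f := fun x => Q.coeff κ * (surfaceEval (MvPolynomial.monomial κ 1) x *
          surfaceEval (zonalLift ξ.1 G) x)) (((hcs κ).mul hcz).const_mul _),
      integral_finsetSum _ fun κ _ => integrable_parabolic hγ hb (by fun_prop)]
    refine Finset.sum_congr rfl fun κ _ => ?_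
    rw [integral_const_mul, integral_const_mul]
    exact congrArg _ (hq2 κ g G hG)

end Transfer

/-! ### Existence of the kernels -/

theorem eq_zero_of_setIntegral_sq_eq_zero {a b : ℝ} (ha : -1 < a) (hb : -1 / 2 < b)
    {p : MvPolynomial (Fin 2) ℝ}
    (h : ∫ x in parabolicDomain, planePoly p x * planePoly p x * parabolicWeight a b x = 0) :
    p = 0 := by
  have hc := continuous_planePoly p
  have hw : ∀ᵐ x ∂volume.restrict parabolicDomain, 0 ≤ parabolicWeight a b x :=
    ae_restrict_of_forall_mem measurableSet_parabolicDomain fun _ => parabolicWeight_nonneg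
  have hi : IntegrableOn (fun x => planePoly p x * planePoly p x * parabolicWeight a b x)
      parabolicDomain := by
    rw [IntegrableOn, ← integrable_withDensity_ofReal (f := fun x => planePoly p x * planePoly p x)
      (measurable_parabolicWeight a b) hw, withDensity_restrict_parabolicDomain ha hb]
    refine Integrable.smul_measure ?_ ENNReal.ofReal_ne_top
    refine (integrable_map_measure (hc.mul hc).aestronglyMeasurable (by fun_prop)).2 ?_
    exact integrable_parabolic ha hb ((hc.mul hc).comp (by fun_prop))
  rw [setIntegral_eq_zero_iff_of_nonneg_ae
    (hw.mono fun x hx => mul_nonneg (mul_self_nonneg _) hx) hi] at h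
  let U : Set (ℝ × ℝ) := {x | x.1 ^ 2 < x.2 ∧ x.2 < 1}
  have hU : IsOpen U :=
    (isOpen_lt (continuous_fst.pow 2) continuous_snd).inter
      (isOpen_lt continuous_snd continuous_const)
  have hUD : U ⊆ parabolicDomain := fun x hx => ⟨hx.1.le, hx.2.le⟩
  have h0 : planePoly p =ᵐ[volume.restrict U] 0 := by
    filter_upwards [ae_restrict_of_ae_restrict_of_subset hUD h, ae_restrict_mem hU.measurableSet]
      with x hx hxU
    have : 0 < parabolicWeight a b x :=
      mul_pos (Real.rpow_pos_of_pos (sub_pos.2 hxU.2) _) (Real.rpow_pos_of_pos (sub_pos.2 hxU.1) _)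
    simpa [this.ne'] using hx
  have h1 := Measure.eqOn_open_of_ae_eq h0 hU hc.continuousOn continuousOn_const
  -- The box `(-1/2, 1/2) × (1/4, 1)` lies inside `x₁² < x₂ < 1`.
  refine MvPolynomial.funext_set ![Ioo (-1 / 2) (1 / 2), Ioo (1 / 4) 1] (fun i => ?_) fun x hx => ?_
  · fin_cases i
    · exact Ioo_infinite (by norm_num)
    · exact Ioo_infinite (by norm_num)
  · have hx0 : x 0 ∈ Ioo (-1 / 2 : ℝ) (1 / 2) := hx 0 (mem_univ _)
    have hx1 : x 1 ∈ Ioo (1 / 4 : ℝ) 1 := hx 1 (mem_univ _)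
    have hxU : (x 0, x 1) ∈ U := ⟨by nlinarith [hx0.1, hx0.2, hx1.1], hx1.2⟩
    have h2 := h1 hxU
    have hx2 : ![x 0, x 1] = x := by
      ext i
      fin_cases i <;> rfl
    rw [map_zero, ← hx2]
    exact h2

/-- The form depends on the product of its arguments only and is definite on polynomials, not merely
on functions on `𝕌`, so existence of the kernel reduces to finite-dimensional linear algebra. -/
theorem exists_parabolicFunctional {a b : ℝ} (ha : -1 < a) (hb : -1 / 2 < b) :
    ∃ Λ : MvPolynomial (Fin 2) ℝ →ₗ[ℝ] ℝ,
      (∀ p q, parabolicInner a b (planePoly p) (planePoly q) = Λ (p * q)) ∧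
      ∀ p, Λ (p * p) = 0 → p = 0 := by
  have hint := fun p : MvPolynomial (Fin 2) ℝ =>
    integrable_parabolic ha hb (f := fun q => planePoly p (√q.2 * (1 - 2 * q.1), q.2))
      ((continuous_planePoly p).comp (by fun_prop))
  let Λ : MvPolynomial (Fin 2) ℝ →ₗ[ℝ] ℝ :=
    { toFun := fun p => parabolicMean a b (planePoly p)
      map_add' := fun p q => by
        rw [parabolicMean, parabolicMean, parabolicMean, ← integral_add (hint p) (hint q)]
        simp [planePoly]
      map_smul' := fun c p => by
        rw [parabolicMean, parabolicMean, RingHom.id_apply, smul_eq_mul, ← integral_const_mul]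
        simp [planePoly, MvPolynomial.smul_eval] }
  have hΛ : ∀ p q, parabolicInner a b (planePoly p) (planePoly q) = Λ (p * q) := fun p q => by
    rw [parabolicInner_eq ha hb (continuous_planePoly p) (continuous_planePoly q)]
    change _ = parabolicMean a b (planePoly (p * q))
    congr 1
    ext x
    simp [planePoly]
  refine ⟨Λ, hΛ, fun p hp => eq_zero_of_setIntegral_sq_eq_zero ha hb ?_⟩
  have hc := continuous_planePoly p
  rw [integral_parabolicDomain ha hb (F := fun x => planePoly p x * planePoly p x) (hc.mul hc),
    ← parabolicInner_eq ha hb hc hc, hΛ, hp, mul_zero]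

theorem isReproducingKernel_parabolicKernel {a b : ℝ} (ha : -1 < a) (hb : -1 / 2 < b) (n : ℕ) :
    IsReproducingKernel (parabolicInner a b) (parabolicOP a b n) (parabolicKernel a b n) := by
  refine Classical.epsilon_spec (p := IsReproducingKernel (parabolicInner a b)
    (parabolicOP a b n)) ?_
  obtain ⟨Λ, hΛ, hpos⟩ := exists_parabolicFunctional ha hb
  let V : Submodule ℝ (MvPolynomial (Fin 2) ℝ) :=
    { carrier := {p | p.totalDegree ≤ n ∧ ∀ q : MvPolynomial (Fin 2) ℝ, q.totalDegree < n →
        Λ (p * q) = 0}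
      add_mem' := fun {p q} hp hq => ⟨(MvPolynomial.totalDegree_add p q).trans (max_le hp.1 hq.1),
        fun r hr => by rw [add_mul, map_add, hp.2 r hr, hq.2 r hr, add_zero]⟩
      zero_mem' := ⟨by simp, by simp⟩
      smul_mem' := fun c p hp => ⟨(MvPolynomial.totalDegree_smul_le c p).trans hp.1,
        fun r hr => by rw [smul_mul_assoc, map_smul, hp.2 r hr, smul_zero]⟩ }
  have hmem : ∀ p ∈ V, planePoly p ∈ parabolicOP a b n := fun p hp =>
    ⟨⟨p, hp.1, rfl⟩, fun q hq => by rw [hΛ, hp.2 q hq]⟩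
  have hV : V ≤ MvPolynomial.restrictTotalDegree (Fin 2) ℝ n := fun p hp =>
    (MvPolynomial.mem_restrictTotalDegree _ _ _).2 hp.1
  have : FiniteDimensional ℝ V := Submodule.finiteDimensional_of_le hV
  -- The Gram map is injective by definiteness, hence onto the dual, so each point evaluation is
  -- represented.
  let B : V →ₗ[ℝ] Module.Dual ℝ V := ((LinearMap.mul ℝ _).compr₂ Λ).domRestrict₁₂ V V
  have hB : Function.Injective B := by
    refine (injective_iff_map_eq_zero B).2 fun p hp => Subtype.ext (hpos _ ?_)
    exact LinearMap.congr_fun hp p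
  rw [LinearMap.injective_iff_surjective_of_finrank_eq_finrank Subspace.dual_finrank_eq.symm] at hB
  choose k hk using fun x : ℝ × ℝ =>
    hB ((MvPolynomial.aeval ![x.1, x.2]).toLinearMap.comp V.subtype)
  refine ⟨fun x => planePoly (k x), fun x => hmem _ (k x).2, ?_⟩
  rintro f ⟨⟨p, hp, rfl⟩, hf⟩ x
  have hpV : p ∈ V := ⟨hp, fun q hq => by rw [← hΛ, hf q hq]⟩
  rw [hΛ, mul_comm]
  exact LinearMap.congr_fun (hk x) ⟨p, hpV⟩

theorem exists_surfacePoint_eq {d : ℕ} [NeZero d] (x : surface d) :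
    ∃ ξ t, surfacePoint ξ t = x := by
  obtain ⟨⟨y, t⟩, hy, ht⟩ := x
  dsimp only at hy ht
  have hyt : √t = ‖y‖ := by rw [← hy, Real.sqrt_sq (norm_nonneg _)]
  rcases eq_or_ne y 0 with rfl | h0
  -- At the apex the direction is arbitrary.
  · refine ⟨⟨EuclideanSpace.single 0 1, by simp⟩, ⟨t, ht⟩, Subtype.ext (Prod.ext ?_ rfl)⟩
    simp [surfacePoint, hyt]
  · refine ⟨⟨‖y‖⁻¹ • y, by simp [norm_smul, h0]⟩, ⟨t, ht⟩, Subtype.ext (Prod.ext ?_ rfl)⟩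
    simp [surfacePoint, hyt, smul_smul, h0]

theorem parabolicInner_comm (a b : ℝ) (f g : ℝ × ℝ → ℝ) :
    parabolicInner a b f g = parabolicInner a b g f := by
  simp only [parabolicInner, mul_comm]

theorem surfaceInner_comm {d : ℕ} (β γ : ℝ) (f g : surface d → ℝ) :
    surfaceInner d β γ f g = surfaceInner d β γ g f := by
  simp only [surfaceInner, mul_comm]

/-! ### The surface kernel as the image of the planar kernel under `τ`. -/

section SurfaceKernel

variable {d : ℕ} [NeZero d] {β γ : ℝ} {τ : ℝ[X] →ₗ[ℝ] ℝ[X]}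

/-- The section is `(τA)(⟨ξ,y⟩, s)`, with `τ` acting on each curve. Transfer turns pairing with it
into pairing with the planar kernel, which annihilates lower degrees and reproduces the value
`q(√t,t)`, that is, the value at `(√t ξ,t)`. -/
theorem exists_surface_section (hd : 2 ≤ d) (hβ : -1 / 2 ≤ β) (hγ : -1 < γ)
    (hτ : ∀ n, τ (zonalPoly (β + ((d : ℝ) - 1) / 2) n) = zonalPoly (((d : ℝ) - 2) / 2) n)
    (hτX : ∀ k, τ (X ^ k) ∈ paritySpace k) {n : ℕ}
    (ξ : Metric.sphere (0 : EuclideanSpace ℝ (Fin d)) 1) (t : Icc (0 : ℝ) 1)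
    {A : MvPolynomial (Fin 2) ℝ} (hAn : A.totalDegree ≤ n)
    (hA : planePoly A = parabolicKernel γ (β + ((d : ℝ) - 1) / 2) n (√(t : ℝ), (t : ℝ))) :
    ∃ k ∈ surfaceOP d β γ n,
      (∀ f ∈ surfaceOP d β γ n, surfaceInner d β γ f k = f (surfacePoint ξ t)) ∧
      ∀ η s, k (surfacePoint η s) = (τ (fibre √(s : ℝ) A)).eval (inner ℝ ξ.1 η.1) := by
  have hd' : (2 : ℝ) ≤ d := by exact_mod_cast hd
  have hb : -1 / 2 < β + ((d : ℝ) - 1) / 2 := by linarith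
  have hK := isReproducingKernel_parabolicKernel hγ hb n
  have htr := exists_transfer hd hb hγ hτ ξ
  obtain ⟨G, hGn, hG⟩ := exists_fibre_eq_map hτX hAn
  have hin : ∀ Q q g G, (∀ g G : MvPolynomial (Fin 2) ℝ, (∀ r, fibre r G = τ (fibre r g)) →
      surfaceMean d (β + ((d : ℝ) - 1) / 2) γ
        (fun x => surfaceEval Q x * surfaceEval (zonalLift ξ.1 G) x) =
      parabolicMean γ (β + ((d : ℝ) - 1) / 2) fun x => planePoly q x * planePoly g x) →
      (∀ r, fibre r G = τ (fibre r g)) →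
      surfaceInner d β γ (surfacePoly Q) (surfacePoly (zonalLift ξ.1 G)) =
        parabolicInner γ (β + ((d : ℝ) - 1) / 2) (planePoly q) (planePoly g) :=
    fun Q q g G h hG => by
      rw [surfaceInner_eq hd hβ hγ, h g G hG,
        parabolicInner_eq hγ hb (continuous_planePoly q) (continuous_planePoly g)]
  refine ⟨surfacePoly (zonalLift ξ.1 G), ⟨⟨_, (totalDegree_zonalLift_le _ _).trans hGn, rfl⟩,
    fun Q hQ => ?_⟩, ?_, fun η s => ?_⟩
  · obtain ⟨q, hq, -, h⟩ := htr Q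
    rw [surfaceInner_comm, hin Q q A G h hG, hA, parabolicInner_comm,
      (hK.mem _).2 q (hq.trans_lt hQ)]
  · rintro f ⟨⟨P, hP, rfl⟩, hf⟩
    obtain ⟨q, hq, hq', h⟩ := htr P
    have hqV : planePoly q ∈ parabolicOP γ (β + ((d : ℝ) - 1) / 2) n := by
      refine ⟨⟨q, hq.trans hP, rfl⟩, fun g hg => ?_⟩
      -- To test `q` against `g` of lower degree, `τg` is lifted to the surface, where it has degree
      -- below `n` and is orthogonal to `P`.
      obtain ⟨G', hGn', hG'⟩ := exists_fibre_eq_map hτX (le_refl g.totalDegree)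
      rw [← hin P q g G' h hG', hf _ ((totalDegree_zonalLift_le _ _).trans_lt (hGn'.trans_lt hg))]
    rw [hin P q A G h hG, hA, hK.reproducing _ hqV, hq' t t.2.1]
    rfl
  · rw [← hG, ← surfaceEval_zonalLift _ _ _ s.2.1]
    rfl

theorem isReproducingKernel_surfaceKernel (hd : 2 ≤ d) (hβ : -1 / 2 ≤ β) (hγ : -1 < γ)
    (hτ : ∀ n, τ (zonalPoly (β + ((d : ℝ) - 1) / 2) n) = zonalPoly (((d : ℝ) - 2) / 2) n)
    (hτX : ∀ k, τ (X ^ k) ∈ paritySpace k) (n : ℕ) :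
    IsReproducingKernel (surfaceInner d β γ) (surfaceOP d β γ n) (surfaceKernel d β γ n) := by
  have hd' : (2 : ℝ) ≤ d := by exact_mod_cast hd
  have hK := isReproducingKernel_parabolicKernel hγ
    (show -1 / 2 < β + ((d : ℝ) - 1) / 2 by linarith) n
  refine Classical.epsilon_spec (p := IsReproducingKernel (surfaceInner d β γ)
    (surfaceOP d β γ n)) ?_
  have : ∀ x : surface d, ∃ k ∈ surfaceOP d β γ n,
      ∀ f ∈ surfaceOP d β γ n, surfaceInner d β γ f k = f x := fun x => by
    obtain ⟨ξ, t, rfl⟩ := exists_surfacePoint_eq x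
    obtain ⟨⟨A, hAn, hA⟩, -⟩ := hK.mem (√(t : ℝ), (t : ℝ))
    obtain ⟨k, hk, hk', -⟩ := exists_surface_section hd hβ hγ hτ hτX ξ t hAn hA.symm
    exact ⟨k, hk, hk'⟩
  choose k hk hk' using this
  exact ⟨k, hk, fun f hf x => hk' x f hf⟩

/-- Two representers of the same evaluation agree, by symmetry of the form. -/
theorem surfaceKernel_eq (hd : 2 ≤ d) (hβ : -1 / 2 ≤ β) (hγ : -1 < γ)
    (hτ : ∀ n, τ (zonalPoly (β + ((d : ℝ) - 1) / 2) n) = zonalPoly (((d : ℝ) - 2) / 2) n)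
    (hτX : ∀ k, τ (X ^ k) ∈ paritySpace k) {n : ℕ}
    (ξ η : Metric.sphere (0 : EuclideanSpace ℝ (Fin d)) 1) (t s : Icc (0 : ℝ) 1)
    {A : MvPolynomial (Fin 2) ℝ} (hAn : A.totalDegree ≤ n)
    (hA : planePoly A = parabolicKernel γ (β + ((d : ℝ) - 1) / 2) n (√(t : ℝ), (t : ℝ))) :
    surfaceKernel d β γ n (surfacePoint ξ t) (surfacePoint η s) =
      (τ (fibre √(s : ℝ) A)).eval (inner ℝ ξ.1 η.1) := by
  have hS := isReproducingKernel_surfaceKernel hd hβ hγ hτ hτX n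
  obtain ⟨k, hk, hk', hk''⟩ := exists_surface_section hd hβ hγ hτ hτX ξ t hAn hA
  rw [← hk'', ← hS.reproducing _ hk, surfaceInner_comm β γ k, hk' _ (hS.mem _),
    ← hS.reproducing _ (hS.mem (surfacePoint ξ t)), surfaceInner_comm,
    hS.reproducing _ (hS.mem _)]

end SurfaceKernel

end Paraboloid

end

/-! ### The two cases of the theorem. -/

theorem mainTheorem1 (d : ℕ) (hd : 2 ≤ d) (γ : ℝ) (hγ : -1 < γ) (n : ℕ) :
    (∀ β : ℝ, -1 / 2 < β →
      Paraboloid.IsReproducingKernel (Paraboloid.surfaceInner d β γ)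
        (Paraboloid.surfaceOP d β γ n) (Paraboloid.surfaceKernel d β γ n) ∧
      Paraboloid.IsReproducingKernel (Paraboloid.parabolicInner γ (β + ((d : ℝ) - 1) / 2))
        (Paraboloid.parabolicOP γ (β + ((d : ℝ) - 1) / 2) n)
        (Paraboloid.parabolicKernel γ (β + ((d : ℝ) - 1) / 2) n) ∧
      ∀ (ξ η : Metric.sphere (0 : EuclideanSpace ℝ (Fin d)) 1) (t s : Set.Icc (0 : ℝ) 1),
        MeasureTheory.IntegrableOn
          (Paraboloid.squareIntegrand d β γ n t s
            (inner ℝ (ξ : EuclideanSpace ℝ (Fin d)) (η : EuclideanSpace ℝ (Fin d))))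
          (Set.Icc (-1 : ℝ) 1 ×ˢ Set.Icc (-1 : ℝ) 1) ∧
        Paraboloid.surfaceKernel d β γ n
            (Paraboloid.surfacePoint ξ t) (Paraboloid.surfacePoint η s) =
          Paraboloid.jacobiConst (((d : ℝ) - 2) / 2) (β - 1 / 2) *
            Paraboloid.gegenbauerConst (β + 1 / 2) *
            ∫ z in Set.Icc (-1 : ℝ) 1 ×ˢ Set.Icc (-1 : ℝ) 1,
              Paraboloid.squareIntegrand d β γ n t s
                (inner ℝ (ξ : EuclideanSpace ℝ (Fin d)) (η : EuclideanSpace ℝ (Fin d))) z) ∧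
    (Paraboloid.IsReproducingKernel (Paraboloid.surfaceInner d (-1 / 2) γ)
        (Paraboloid.surfaceOP d (-1 / 2) γ n) (Paraboloid.surfaceKernel d (-1 / 2) γ n) ∧
      Paraboloid.IsReproducingKernel (Paraboloid.parabolicInner γ (((d : ℝ) - 2) / 2))
        (Paraboloid.parabolicOP γ (((d : ℝ) - 2) / 2) n)
        (Paraboloid.parabolicKernel γ (((d : ℝ) - 2) / 2) n) ∧
      ∀ (ξ η : Metric.sphere (0 : EuclideanSpace ℝ (Fin d)) 1) (t s : Set.Icc (0 : ℝ) 1),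
        Paraboloid.surfaceKernel d (-1 / 2) γ n
            (Paraboloid.surfacePoint ξ t) (Paraboloid.surfacePoint η s) =
          Paraboloid.parabolicKernel γ (((d : ℝ) - 2) / 2) n (√(t : ℝ), (t : ℝ))
            (inner ℝ (ξ : EuclideanSpace ℝ (Fin d)) (√(s : ℝ) • (η : EuclideanSpace ℝ (Fin d))),
              (s : ℝ))) := by
  open Paraboloid in
  have : NeZero d := ⟨by omega⟩
  have hd' : (2 : ℝ) ≤ d := by exact_mod_cast hd
  constructor
  · intro β hβ
    have hb : -1 / 2 < β + ((d : ℝ) - 1) / 2 := by linarith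
    have hl : -1 < ((d : ℝ) - 2) / 2 := by linarith
    have hs : 0 < β + 1 / 2 := by linarith
    have hτ : ∀ n, averageMap (((d : ℝ) - 2) / 2) (β + 1 / 2)
        (zonalPoly (β + ((d : ℝ) - 1) / 2) n) = zonalPoly (((d : ℝ) - 2) / 2) n := fun n => by
      -- The gap between the two parameters is `s = β + 1/2`.
      rw [show β + ((d : ℝ) - 1) / 2 = ((d : ℝ) - 2) / 2 + (β + 1 / 2) by ring,
        averageMap_zonalPoly hl hs]
    have hτX := fun k => averageMap_X_pow_mem (l := ((d : ℝ) - 2) / 2) hs k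
    have hK := isReproducingKernel_parabolicKernel hγ hb n
    refine ⟨isReproducingKernel_surfaceKernel hd hβ.le hγ hτ hτX n, hK, fun ξ η t s => ?_⟩
    obtain ⟨⟨A, hAn, hA⟩, -⟩ := hK.mem (√(t : ℝ), (t : ℝ))
    have hF : Continuous fun z : ℝ × ℝ => parabolicKernel γ (β + ((d : ℝ) - 1) / 2) n
        (√(t : ℝ), (t : ℝ)) (√(s : ℝ) * ((1 - z.1) / 2 * inner ℝ ξ.1 η.1 +
          (1 + z.1) / 2 * z.2), (s : ℝ)) := by
      rw [hA]
      exact (continuous_planePoly A).comp (by fun_prop)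
    have hβ' : -1 < β - 1 / 2 := by linarith
    have hβ'' : -1 < β := by linarith
    refine ⟨integrableOn_square hl hβ' hβ'' hF, ?_⟩
    refine Eq.trans ?_ (integral_square hl hβ' hβ'' hF).symm
    rw [surfaceKernel_eq hd hβ.le hγ hτ hτX ξ η t s hAn hA.symm, averageMap_eval hl hs,
      show β - 1 / 2 + 1 = β + 1 / 2 by ring, show β + 1 / 2 + 1 / 2 = β + 1 by ring, hA]
    -- With `z₁ = 1 - 2p` the weights `(1-z₁)/2` and `(1+z₁)/2` are `p` and `1 - p`.
    refine MeasureTheory.integral_congr_ae (.of_forall fun q => ?_)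
    dsimp only
    rw [eval_fibre, Real.sq_sqrt s.2.1]
    congr 3
    ring
  · have hb : (-1 / 2 : ℝ) + ((d : ℝ) - 1) / 2 = ((d : ℝ) - 2) / 2 := by ring
    -- At `β = -1/2` the gap closes and no averaging is needed.
    have hτ : ∀ n, (LinearMap.id : Polynomial ℝ →ₗ[ℝ] Polynomial ℝ)
        (zonalPoly (-1 / 2 + ((d : ℝ) - 1) / 2) n) = zonalPoly (((d : ℝ) - 2) / 2) n := fun n => by
      rw [hb, LinearMap.id_apply]
    have hτX : ∀ k, (LinearMap.id : Polynomial ℝ →ₗ[ℝ] Polynomial ℝ) (Polynomial.X ^ k) ∈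
        paritySpace k := fun k => X_pow_mem_paritySpace k 0
    have hK := isReproducingKernel_parabolicKernel hγ
      (show -1 / 2 < ((d : ℝ) - 2) / 2 by linarith) n
    refine ⟨isReproducingKernel_surfaceKernel hd le_rfl hγ hτ hτX n, hK, fun ξ η t s => ?_⟩
    obtain ⟨⟨A, hAn, hA⟩, -⟩ := hK.mem (√(t : ℝ), (t : ℝ))
    rw [surfaceKernel_eq hd le_rfl hγ hτ hτX ξ η t s hAn (by rw [hb, hA]), LinearMap.id_apply,
      eval_fibre, Real.sq_sqrt s.2.1, hA, inner_smul_right]
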